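/- Let $X$ be a compact metrizable space with a Borel probability measure $\mu_0$, and let $\mathcal P(X)$ be the space of Borel probability measures on $X$ with the weak topology. Let $W:X\times X\to[-\infty,\infty]$ be symmetric and $\mu_0^{\otimes 2}$-measurable, with $$\int_{X^2}e^{-tW}\,d\mu_0^{\otimes 2}<\infty\qquad\text{for every } t\in\mathbb R .$$ For $N\ge 1$ put $$H^{(N)}(x_1,\dots,x_N)=\frac1N\sum_{i\neq j}W(x_i,x_j),\qquad \delta_N(x_1,\dots,x_N)=\frac1N\sum_{i=1}^N\delta_{x_i}\in\mathcal P(X),$$ the first sum being over ordered pairs of distinct indices ($H^{(N)}$ is finite $\mu_0^{\otimes N}$-almost everywhere), and for $\beta\in\mathbb R$ put $Z_{N,\beta}=\int_{X^N}e^{-\beta H^{(N)}}d\mu_0^{\otimes N}$ and $\mu_\beta^{(N)}=Z_{N,\beta}^{-1}e^{-\beta H^{(N)}}\mu_0^{\otimes N}$. Let $D(\mu)=\int\log\frac{d\mu}{d\mu_0}\,d\mu\in[0,\infty]$ be the entropy of $\mu\in\mathcal P(X)$ relative to $\mu_0$ (with $D(\mu)=\infty$ if $\mu$ is not absolutely continuous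 with respect to $\mu_0$), let $E(\mu)=\int_{X^2}W\,d\mu^{\otimes2}$, and let $$\beta F_\beta(\mu)=\beta E(\mu)+D(\mu)\ \text{ if } D(\mu)<\infty,\qquad \beta F_\beta(\mu)=\infty\ \text{ if } D(\mu)=\infty .$$ Measures $\Gamma_N$ ($N\geq 1$) on $\mathcal P(X)$ are said to satisfy a large deviation principle (LDP) with speed $N$ and rate functional $I:\mathcal P(X)\to\,]-\infty,\infty]$ if $I$ is lower semi-continuous, $\limsup_{N}\frac1N\log\Gamma_N(\mathcal F)\le-\inf_{\mathcal F}I$ for every closed $\mathcal F\subset\mathcal P(X)$, and $\liminf_{N}\frac1N\log\Gamma_N(\mathcal G)\ge-\inf_{\mathcal G}I$ for every open $\mathcal G\subset\mathcal P(X)$. Then, for every $\beta\in\,]-\infty,\infty[$ (including negative values): 1. $0<Z_{N,\beta}<\infty$ for all $N\ge1$, so that $\mu_\beta^{(N)}$ is a well-defined probability measure; and $W\in L^1(\mu^{\otimes 2})$ whenever $D(\mu)<\infty$, so that $\beta F_\beta$ is well defined. 2. The non-normalized measures $(\delta_N)_*(e^{-\beta H^{(N)}}\mu_0^{\otimes N})$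 satisfy an LDP with speed $N$ and rate functional $\beta F_\beta$. 3. Equivalently, in normalized form, $\inf_{\mathcal P(X)}\beta F_\beta$ is finite, and the laws $(\delta_N)_*\mu_\beta^{(N)}$ of the empirical measures under the Gibbs measures satisfy an LDP with speed $N$ and rate functional $\beta F_\beta-\inf_{\mathcal P(X)}\beta F_\beta$. -/

import Mathlib

open MeasureTheory Filter Topology
open scoped ENNReal

/-- `I : Y → ]-∞, ∞]` is a rate function if it is lower semi-continuous. -/
def IsRateFunction {Y : Type*} [TopologicalSpace Y] (I : Y → EReal) : Prop :=
  LowerSemicontinuous I ∧ ∀ y, I y ≠ ⊥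

/-- The (not necessarily normalized) measures `Γ N`, `N = 1, 2, …`, on `Y` satisfy a large deviation
principle with speed `r N` and rate function `I`. -/
def SatisfiesLDP {Y : Type*} [TopologicalSpace Y] [MeasurableSpace Y]
    (Γ : ℕ+ → Measure Y) (r : ℕ+ → ℝ) (I : Y → EReal) : Prop :=
  IsRateFunction I ∧
  (∀ F : Set Y, IsClosed F →
    limsup (fun N : ℕ+ => (((r N)⁻¹ : ℝ) : EReal) * ENNReal.log (Γ N F)) atTop ≤ -⨅ y ∈ F, I y) ∧
  (∀ G : Set Y, IsOpen G →
    -⨅ y ∈ G, I y ≤ liminf (fun N : ℕ+ => (((r N)⁻¹ : ℝ) : EReal) * ENNReal.log (Γ N G)) atTop)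

section MeanField

variable {X : Type*} [MeasurableSpace X]

/-- The empirical measure `δ_N(x₁, …, x_N) = (1/N) ∑ᵢ δ_{xᵢ}`. -/
noncomputable def empiricalMeasure (N : ℕ+) (x : Fin N → X) : ProbabilityMeasure X :=
  ⟨((N : ℕ) : ℝ≥0∞)⁻¹ • ∑ i, Measure.dirac (x i), ⟨by
    have h0 : ((N : ℕ) : ℝ≥0∞) ≠ 0 := by exact_mod_cast N.pos.ne'
    simp [ENNReal.inv_mul_cancel h0 (ENNReal.natCast_ne_top _)]⟩⟩

/-- The mean field Hamiltonian `H^{(N)}(x₁, …, x_N) = (1/N) ∑_{i ≠ j} W(xᵢ, xⱼ)`, the sum running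
over all ordered pairs of distinct indices. -/
noncomputable def meanFieldHamiltonian (W : X → X → EReal) (N : ℕ+) (x : Fin N → X) : EReal :=
  (((N : ℝ)⁻¹ : ℝ) : EReal) * ∑ p ∈ (Finset.univ : Finset (Fin N)).offDiag, W (x p.1) (x p.2)

/-- The non-normalized Gibbs measure `e^{-β H^{(N)}} μ₀^{⊗N}` on `X^N`. -/
noncomputable def gibbsWeight (μ₀ : Measure X) (W : X → X → EReal) (β : ℝ) (N : ℕ+) :
    Measure (Fin N → X) :=
  (Measure.pi fun _ : Fin N => μ₀).withDensity
    fun x => EReal.exp (-((β : EReal) * meanFieldHamiltonian W N x))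

/-- The partition function `Z_{N,β} = ∫ e^{-β H^{(N)}} dμ₀^{⊗N}`. -/
noncomputable def partitionFunction (μ₀ : Measure X) (W : X → X → EReal) (β : ℝ) (N : ℕ+) : ℝ≥0∞ :=
  ∫⁻ x, EReal.exp (-((β : EReal) * meanFieldHamiltonian W N x)) ∂(Measure.pi fun _ : Fin N => μ₀)

/-- The Gibbs measure `μ_β^{(N)} = e^{-β H^{(N)}} μ₀^{⊗N} / Z_{N,β}` on `X^N`. -/
noncomputable def gibbsMeasure (μ₀ : Measure X) (W : X → X → EReal) (β : ℝ) (N : ℕ+) :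
    Measure (Fin N → X) :=
  (partitionFunction μ₀ W β N)⁻¹ • gibbsWeight μ₀ W β N

/-- The energy `E(μ) = ∫ W dμ^{⊗2}`, as the integral of the positive part minus the integral of the
negative part. -/
noncomputable def pairEnergy (W : X → X → EReal) (μ : ProbabilityMeasure X) : EReal :=
  ((∫⁻ p, (W p.1 p.2).toENNReal ∂((μ : Measure X).prod (μ : Measure X)) : ℝ≥0∞) : EReal) -
    ((∫⁻ p, (-W p.1 p.2).toENNReal ∂((μ : Measure X).prod (μ : Measure X)) : ℝ≥0∞) : EReal)

/-- The relative entropy `D(μ) = D(μ, μ₀) ∈ [0, ∞]`. -/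
noncomputable def relEntropy (μ₀ : Measure X) (μ : ProbabilityMeasure X) : ℝ≥0∞ :=
  InformationTheory.klDiv (μ : Measure X) μ₀

open Classical in
/-- The functional `βF_β = βE + D` on the space of probability measures, equal to `∞` where
`D = ∞`. -/
noncomputable def freeEnergy (μ₀ : Measure X) (W : X → X → EReal) (β : ℝ)
    (μ : ProbabilityMeasure X) : EReal :=
  if relEntropy μ₀ μ = ∞ then ⊤
  else (β : EReal) * pairEnergy W μ + (relEntropy μ₀ μ : EReal)

end MeanField

/-! Everything rests on two local estimates around each `μ`: some neighbourhood has mass at most,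
and every neighbourhood has mass at least, `exp (-N (βF_β(μ) ∓ ε))`. Since `P(X)` is compact, these
alone give the LDP, the lower semicontinuity of `βF_β` and the normalized form
(`satisfiesLDP_of_local`, `LocalUpperBound.normalized`, `LocalLowerBound.normalized`). The
interaction may be replaced by a real-valued measurable `w` with all exponential moments of `|w|`
finite.

Upper bound. The energy of `w` need not be weakly continuous, so `w` is replaced by a continuous `v`
for which `exp (t |w - v|)` has integral at most 2, with `t` large. Hölder's inequality with weights
`1 - θ` and `θ` separates the probability of a neighbourhood from the replacement error. That error
is the exponential of a mean field pair sum. Averaging over permutations writes the sum through sums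
over disjoint, hence independent, pairs, and Jensen's inequality bounds its integral by `exp N`
(`lintegral_exp_pairSum_le`). The same exponential bound and the entropy inequality make the
energies of `w` and `v` at `μ` differ by `O(θ (1 + D(μ)))`. The probability itself is bounded by
exponential Chebyshev, with a continuous `f` nearly attaining `D(μ) = sup_f (∫ f dμ + 1 - ∫ exp f
dμ₀)`.

Lower bound. Under `μ^{⊗N}` the weight becomes `exp (-f_N)` with `f_N = β H^{(N)} + ∑ log
(dμ/dμ₀)(x_i)`, whose mean is about `N βF_β(μ)`. A tangent line to the exponential uses only first
moments of `f_N`; uniform integrability and the weak law of large numbers confine them to the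
neighbourhood.

Only `|β|` and `|w - v|` enter the error estimates, so the sign of `β` plays no role. -/

/-! ### Exponential rates. -/

lemma tendsto_pnat_cast_atTop : Tendsto (fun N : ℕ+ => ((N : ℕ) : ℝ)) atTop atTop :=
  tendsto_natCast_atTop_atTop.comp tendsto_PNat_val_atTop_atTop

lemma eventually_const_mul_exp_le (C : ℝ) {a a' : ℝ} (h : a' < a) :
    ∀ᶠ N : ℕ+ in atTop, C * Real.exp (-(N * a)) ≤ Real.exp (-(N * a')) := by
  have h1 : Tendsto (fun N : ℕ+ => Real.exp (((N : ℕ) : ℝ) * (a - a'))) atTop atTop :=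
    Real.tendsto_exp_atTop.comp (tendsto_pnat_cast_atTop.atTop_mul_const (sub_pos.2 h))
  filter_upwards [h1.eventually_ge_atTop C] with N hN
  calc C * Real.exp (-(N * a)) ≤ Real.exp (((N : ℕ) : ℝ) * (a - a')) * Real.exp (-(N * a)) := by
        gcongr
    _ = Real.exp (-(N * a')) := by rw [← Real.exp_add]; congr 1; ring

lemma inv_mul_log_ofReal_exp (N : ℕ+) (a : ℝ) :
    (((N : ℝ)⁻¹ : ℝ) : EReal) * ENNReal.log (ENNReal.ofReal (Real.exp (-(N * a)))) =
      ((-a : ℝ) : EReal) := by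
  rw [ENNReal.log_ofReal_of_pos (Real.exp_pos _), Real.log_exp, ← EReal.coe_mul]
  have : ((N : ℕ) : ℝ) ≠ 0 := by exact_mod_cast N.pos.ne'
  congr 1
  field_simp

lemma inv_mul_log_mono (N : ℕ+) {m m' : ℝ≥0∞} (h : m ≤ m') :
    (((N : ℝ)⁻¹ : ℝ) : EReal) * ENNReal.log m ≤ (((N : ℝ)⁻¹ : ℝ) : EReal) * ENNReal.log m' :=
  mul_le_mul_of_nonneg_left (ENNReal.log_le_log h)
    (by exact_mod_cast inv_nonneg.2 (Nat.cast_nonneg (N : ℕ)))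

lemma limsup_inv_mul_log_le {m : ℕ+ → ℝ≥0∞} {a : ℝ}
    (h : ∀ᶠ N : ℕ+ in atTop, m N ≤ ENNReal.ofReal (Real.exp (-(N * a)))) :
    limsup (fun N : ℕ+ => (((N : ℝ)⁻¹ : ℝ) : EReal) * ENNReal.log (m N)) atTop ≤
      ((-a : ℝ) : EReal) := by
  refine limsup_le_of_le (by isBoundedDefault) ?_
  filter_upwards [h] with N hN
  exact (inv_mul_log_mono N hN).trans (inv_mul_log_ofReal_exp N a).le

lemma le_liminf_inv_mul_log {m : ℕ+ → ℝ≥0∞} {a : ℝ}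
    (h : ∀ᶠ N : ℕ+ in atTop, ENNReal.ofReal (Real.exp (-(N * a))) ≤ m N) :
    ((-a : ℝ) : EReal) ≤
      liminf (fun N : ℕ+ => (((N : ℝ)⁻¹ : ℝ) : EReal) * ENNReal.log (m N)) atTop := by
  refine le_liminf_of_le (by isBoundedDefault) ?_
  filter_upwards [h] with N hN
  exact (inv_mul_log_ofReal_exp N a).ge.trans (inv_mul_log_mono N hN)

/-! ### From local exponential bounds to large deviations on a compact space. -/

section LocalBounds

variable {Y : Type*} [TopologicalSpace Y] [MeasurableSpace Y]

/-- Local exponential upper bounds, at rate arbitrarily close to `I y` near each point `y`. -/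
def LocalUpperBound (Γ : ℕ+ → Measure Y) (I : Y → EReal) : Prop :=
  ∀ y, ∀ a : ℝ, (a : EReal) < I y → ∃ U : Set Y, IsOpen U ∧ y ∈ U ∧
    ∀ᶠ N : ℕ+ in atTop, Γ N U ≤ ENNReal.ofReal (Real.exp (-(N * a)))

/-- Local exponential lower bounds, at rate arbitrarily close to `I y` near each point `y`. -/
def LocalLowerBound (Γ : ℕ+ → Measure Y) (I : Y → EReal) : Prop :=
  ∀ y, ∀ a : ℝ, I y < a → ∀ U : Set Y, IsOpen U → y ∈ U →
    ∀ᶠ N : ℕ+ in atTop, ENNReal.ofReal (Real.exp (-(N * a))) ≤ Γ N U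

variable {Γ : ℕ+ → Measure Y} {I : Y → EReal}

lemma LocalUpperBound.of_isCompact (h : LocalUpperBound Γ I) {K : Set Y} (hK : IsCompact K)
    {a a' : ℝ} (ha : a' < a) (hI : ∀ y ∈ K, (a : EReal) < I y) :
    ∀ᶠ N : ℕ+ in atTop, Γ N K ≤ ENNReal.ofReal (Real.exp (-(N * a'))) := by
  choose! U hUo hyU hU using fun y (hy : y ∈ K) => h y a (hI y hy)
  obtain ⟨t, htK, ht⟩ := hK.elim_nhds_subcover U fun y hy => (hUo y hy).mem_nhds (hyU y hy)
  have h1 : ∀ᶠ N : ℕ+ in atTop, ∀ y ∈ t, Γ N (U y) ≤ ENNReal.ofReal (Real.exp (-(N * a))) :=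
    (Filter.eventually_all_finset t).2 fun y hy => hU y (htK y hy)
  filter_upwards [h1, eventually_const_mul_exp_le t.card ha] with N hN hN'
  calc Γ N K ≤ ∑ y ∈ t, Γ N (U y) := (measure_mono ht).trans (measure_biUnion_finset_le t U)
    _ ≤ ∑ _y ∈ t, ENNReal.ofReal (Real.exp (-(N * a))) := Finset.sum_le_sum hN
    _ = ENNReal.ofReal (t.card * Real.exp (-(N * a))) := by
        rw [Finset.sum_const, nsmul_eq_mul, ENNReal.ofReal_mul (Nat.cast_nonneg _),
          ENNReal.ofReal_natCast]
    _ ≤ _ := ENNReal.ofReal_le_ofReal hN'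

/-- A neighbourhood `U` of `y` with mass at most `exp (-N a)` cannot contain a point of rate below
`a`, since the lower bound at that point would give `U` too much mass. -/
lemma LocalUpperBound.lowerSemicontinuous (h : LocalUpperBound Γ I) (h' : LocalLowerBound Γ I) :
    LowerSemicontinuous I := by
  intro y b hb
  obtain ⟨a, hba, hay⟩ := EReal.lt_iff_exists_real_btwn.1 hb
  obtain ⟨U, hUo, hyU, hU⟩ := h y a hay
  filter_upwards [hUo.mem_nhds hyU] with z hz
  refine hba.trans_le (not_lt.1 fun hlt => ?_)
  obtain ⟨a', hza', ha'⟩ := EReal.lt_iff_exists_real_btwn.1 hlt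
  obtain ⟨N, hN, hN'⟩ := (hU.and (h' z a' hza' U hUo hz)).exists
  have h1 := (ENNReal.ofReal_le_ofReal_iff (Real.exp_pos _).le).1 (hN'.trans hN)
  rw [Real.exp_le_exp, neg_le_neg_iff] at h1
  have h2 : (0 : ℝ) < ((N : ℕ) : ℝ) := by exact_mod_cast N.pos
  exact absurd (le_of_mul_le_mul_left h1 h2) (not_le.2 (EReal.coe_lt_coe_iff.1 ha'))

/-- Closed sets are compact here, so finitely many local neighbourhoods cover them, and their number
is absorbed by an arbitrarily small loss in the rate. -/
theorem satisfiesLDP_of_local [CompactSpace Y] (hI : ∀ y, I y ≠ ⊥) (h : LocalUpperBound Γ I)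
    (h' : LocalLowerBound Γ I) : SatisfiesLDP Γ (fun N => (N : ℝ)) I := by
  refine ⟨⟨h.lowerSemicontinuous h', hI⟩, fun F hF => ?_, fun G hG => ?_⟩
  · refine not_lt.1 fun hlt => ?_
    obtain ⟨r, hr, hr'⟩ := EReal.lt_iff_exists_real_btwn.1 hlt
    have h1 : ((-r : ℝ) : EReal) < ⨅ y ∈ F, I y := by
      rw [EReal.coe_neg]; exact EReal.neg_lt_comm.1 hr
    obtain ⟨a, hra, ha⟩ := EReal.lt_iff_exists_real_btwn.1 h1
    have h2 := limsup_inv_mul_log_le (h.of_isCompact hF.isCompact (EReal.coe_lt_coe_iff.1 hra)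
      fun y hy => ha.trans_le (iInf₂_le y hy))
    rw [neg_neg] at h2
    exact absurd hr' (not_lt.2 h2)
  · rw [EReal.neg_le]
    refine le_iInf₂ fun y hy => ?_
    rw [EReal.neg_le]
    refine not_lt.1 fun hlt => ?_
    obtain ⟨r, hr, hr'⟩ := EReal.lt_iff_exists_real_btwn.1 hlt
    have h1 : I y < ((-r : ℝ) : EReal) := by
      rw [EReal.coe_neg]; exact EReal.lt_neg_comm.1 hr'
    have h2 := le_liminf_inv_mul_log (h' y (-r) h1 G hG hy)
    rw [neg_neg] at h2
    exact absurd hr (not_lt.2 h2)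

/-- A near-minimizer `z` of `I` bounds the total mass from below by about `exp (-N c)`, which is
what division requires. -/
lemma LocalUpperBound.normalized {c : ℝ} (hc : ⨅ y, I y = c)
    (h : LocalUpperBound Γ I) (h' : LocalLowerBound Γ I) :
    LocalUpperBound (fun N => (Γ N Set.univ)⁻¹ • Γ N) (fun y => I y - c) := by
  intro y a ha
  have h1 : ((a + c : ℝ) : EReal) < I y := by
    rw [EReal.coe_add]; exact EReal.add_lt_of_lt_sub ha
  obtain ⟨a₁, h1a, h1'⟩ := EReal.lt_iff_exists_real_btwn.1 h1
  have h1a : a + c < a₁ := EReal.coe_lt_coe_iff.1 h1a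
  obtain ⟨U, hUo, hyU, hU⟩ := h y a₁ h1'
  refine ⟨U, hUo, hyU, ?_⟩
  have h2 : ⨅ y, I y < ((a₁ - a : ℝ) : EReal) := by
    rw [hc]; exact EReal.coe_lt_coe_iff.2 (by linarith)
  obtain ⟨z, hz⟩ := iInf_lt_iff.1 h2
  filter_upwards [hU, h' z _ hz Set.univ isOpen_univ trivial] with N hN hN'
  rw [Measure.smul_apply, smul_eq_mul]
  calc (Γ N Set.univ)⁻¹ * Γ N U
      ≤ (ENNReal.ofReal (Real.exp (-(N * (a₁ - a)))))⁻¹ *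
        ENNReal.ofReal (Real.exp (-(N * a₁))) := by gcongr
    _ = ENNReal.ofReal (Real.exp (-(N * a))) := by
        rw [← ENNReal.ofReal_inv_of_pos (Real.exp_pos _), ← ENNReal.ofReal_mul (by positivity),
          ← Real.exp_neg, ← Real.exp_add]
        congr 2; ring

/-- Here the total mass must be bounded from above, and this is where compactness of the whole space
is used. -/
lemma LocalLowerBound.normalized [CompactSpace Y] {c : ℝ} (hc : ⨅ y, I y = c)
    (h : LocalUpperBound Γ I) (h' : LocalLowerBound Γ I) :
    LocalLowerBound (fun N => (Γ N Set.univ)⁻¹ • Γ N) (fun y => I y - c) := by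
  intro y a ha U hUo hyU
  have h1 : I y < ((a + c : ℝ) : EReal) := by
    rw [EReal.coe_add]
    exact (EReal.sub_lt_iff (by simp) (by simp)).1 ha
  obtain ⟨a₁, h1a, h1'⟩ := EReal.lt_iff_exists_real_btwn.1 h1
  have h1' : a₁ < a + c := EReal.coe_lt_coe_iff.1 h1'
  obtain ⟨b, hb1, hb2⟩ := exists_between (show a₁ - a < c by linarith)
  have h2 : ∀ᶠ N : ℕ+ in atTop,
      Γ N Set.univ ≤ ENNReal.ofReal (Real.exp (-(N * (a₁ - a)))) :=
    h.of_isCompact isCompact_univ hb1 fun y _ =>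
      (EReal.coe_lt_coe_iff.2 hb2).trans_le (hc ▸ iInf_le I y)
  filter_upwards [h2, h' y _ h1a U hUo hyU] with N hN hN'
  rw [Measure.smul_apply, smul_eq_mul]
  calc ENNReal.ofReal (Real.exp (-(N * a)))
      = (ENNReal.ofReal (Real.exp (-(N * (a₁ - a)))))⁻¹ *
        ENNReal.ofReal (Real.exp (-(N * a₁))) := by
        rw [← ENNReal.ofReal_inv_of_pos (Real.exp_pos _), ← ENNReal.ofReal_mul (by positivity),
          ← Real.exp_neg, ← Real.exp_add]
        congr 2; ring
    _ ≤ (Γ N Set.univ)⁻¹ * Γ N U := by gcongr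

end LocalBounds

/-! ### Continuous approximation under a uniform bound. -/

lemma abs_sub_clamp_le {s M : ℝ} (t : ℝ) (h : |s| ≤ M) : |s - max (-M) (min M t)| ≤ |s - t| := by
  obtain ⟨h1, h2⟩ := abs_le.1 h
  rcases le_total M t with h3 | h3
  · rw [min_eq_left h3, max_eq_right (by linarith), abs_of_nonpos (by linarith),
      abs_of_nonpos (by linarith)]
    linarith
  · rw [min_eq_right h3]
    rcases le_total (-M) t with h4 | h4
    · rw [max_eq_right h4]
    · rw [max_eq_left h4, abs_of_nonneg (by linarith), abs_of_nonneg (by linarith)]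
      linarith

lemma abs_clamp_le {M : ℝ} (hM : 0 ≤ M) (t : ℝ) : |max (-M) (min M t)| ≤ M :=
  abs_le.2 ⟨le_max_left _ _, max_le (by linarith) (min_le_left _ _)⟩

/-- Clamping an `L¹` approximant to `[-M, M]` brings it no further from `f`. Keeping the bound `M`
is essential later, when exponentials of `f` and `g` are compared. -/
lemma exists_continuousMap_integral_abs_sub_le {Y : Type*} [TopologicalSpace Y] [CompactSpace Y]
    [TopologicalSpace.MetrizableSpace Y] [MeasurableSpace Y] [BorelSpace Y] (ν : Measure Y)
    [IsFiniteMeasure ν] {f : Y → ℝ} (hf : Measurable f) {M : ℝ} (hM : 0 ≤ M)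
    (hfM : ∀ y, |f y| ≤ M) {ε : ℝ} (hε : 0 < ε) :
    ∃ g : C(Y, ℝ), (∀ y, |g y| ≤ M) ∧ ∫ y, |f y - g y| ∂ν ≤ ε := by
  have hfi : Integrable f ν :=
    .of_bound hf.aestronglyMeasurable M (ae_of_all _ fun y => hfM y)
  obtain ⟨g, hg, hgi⟩ := hfi.exists_boundedContinuous_integral_sub_le hε
  refine ⟨⟨fun y => max (-M) (min M (g y)), by fun_prop⟩, fun y => abs_clamp_le hM _, ?_⟩
  refine le_trans (integral_mono_of_nonneg (ae_of_all _ fun y => abs_nonneg _)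
    (hfi.sub hgi).norm (ae_of_all _ fun y => ?_)) hg
  exact abs_sub_clamp_le _ (hfM y)

lemma integrable_continuousMap {Y : Type*} [TopologicalSpace Y] [CompactSpace Y]
    [MeasurableSpace Y] [OpensMeasurableSpace Y] (ν : Measure Y) [IsFiniteMeasure ν] (g : C(Y, ℝ)) :
    Integrable g ν :=
  .of_bound (Continuous.measurable g.continuous).aestronglyMeasurable ‖g‖
    (ae_of_all _ fun y => g.norm_coe_le_norm y)

/-! ### Test functions for the relative entropy. -/

section Entropy

variable {X : Type*} [MeasurableSpace X]

/-- The logarithm truncated to `[-n, n]`, with value `-n` at zero. -/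
noncomputable def truncLog (n : ℕ) (r : ℝ) : ℝ :=
  if r = 0 then -n else max (-(n : ℝ)) (min n (Real.log r))

lemma measurable_truncLog (n : ℕ) : Measurable (truncLog n) :=
  Measurable.ite (measurableSet_singleton 0) measurable_const
    (measurable_const.max (measurable_const.min Real.measurable_log))

lemma abs_truncLog_le (n : ℕ) (r : ℝ) : |truncLog n r| ≤ n := by
  unfold truncLog
  split_ifs
  · simp
  · exact abs_clamp_le (Nat.cast_nonneg n) _

/-- For `r > 0`, `s ↦ r s + 1 - exp s` is concave, vanishes at 0 and peaks at `log r`; the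
truncation lies between these two points. Nonnegativity is what Fatou's lemma needs. -/
lemma mul_truncLog_add_nonneg {r : ℝ} (hr : 0 ≤ r) (n : ℕ) :
    0 ≤ r * truncLog n r + 1 - Real.exp (truncLog n r) := by
  have hn : (0 : ℝ) ≤ n := Nat.cast_nonneg n
  unfold truncLog
  rcases hr.eq_or_lt with rfl | hr
  · simp [hn]
  rw [if_neg hr.ne']
  have key : ∀ s : ℝ, s * Real.exp s + 1 - Real.exp s ≥ 0 := fun s => by
    have h1 := Real.add_one_le_exp (-s)
    have h2 := Real.exp_pos s
    have h3 : Real.exp s * Real.exp (-s) = 1 := by rw [← Real.exp_add]; simp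
    nlinarith
  rcases le_total (n : ℝ) (Real.log r) with h3 | h3
  · rw [min_eq_left h3, max_eq_right (by linarith)]
    have h4 : Real.exp n ≤ r := (Real.le_log_iff_exp_le hr).1 h3
    nlinarith [key n]
  · rw [min_eq_right h3]
    rcases le_total (-(n : ℝ)) (Real.log r) with h4 | h4
    · rw [max_eq_right h4]
      have := key (Real.log r)
      rw [Real.exp_log hr] at this ⊢
      linarith
    · rw [max_eq_left h4]
      have h5 : r ≤ Real.exp (-n) := (Real.log_le_iff_le_exp hr).1 h4
      nlinarith [key (-n)]

lemma tendsto_clamp (t : ℝ) : Tendsto (fun n : ℕ => max (-(n : ℝ)) (min n t)) atTop (𝓝 t) := by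
  refine tendsto_const_nhds.congr' ?_
  filter_upwards [eventually_ge_atTop ⌈|t|⌉₊] with n hn
  obtain ⟨h1, h2⟩ := abs_le.1 (Nat.ceil_le.1 hn)
  rw [min_eq_right h2, max_eq_right h1]

/-- At `r = 0` the value `-n` makes the expression tend to `klFun 0 = 1`; the default `Real.log 0 =
0` would give 0. -/
lemma tendsto_mul_truncLog {r : ℝ} (hr : 0 ≤ r) :
    Tendsto (fun n : ℕ => r * truncLog n r + 1 - Real.exp (truncLog n r)) atTop
      (𝓝 (InformationTheory.klFun r)) := by
  unfold truncLog
  rcases hr.eq_or_lt with rfl | hr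
  · have h : Tendsto (fun n : ℕ => Real.exp (-(n : ℝ))) atTop (𝓝 0) :=
      Real.tendsto_exp_neg_atTop_nhds_zero.comp tendsto_natCast_atTop_atTop
    simpa [InformationTheory.klFun_zero] using h.const_sub 1
  · have := tendsto_clamp (Real.log r)
    have h2 := ((this.const_mul r).add_const 1).sub ((Real.continuous_exp.tendsto _).comp this)
    rw [Real.exp_log hr] at h2
    simpa [hr.ne', InformationTheory.klFun_apply] using h2

/-- A bounded measurable test function nearly attaining the relative entropy. -/
lemma exists_measurable_lt_of_lt_klDiv {μ μ₀ : Measure X} [IsProbabilityMeasure μ]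
    [IsProbabilityMeasure μ₀] {a : ℝ}
    (ha : (a : EReal) < ((InformationTheory.klDiv μ μ₀ : ℝ≥0∞) : EReal)) :
    ∃ f : X → ℝ, Measurable f ∧ (∃ M, 0 ≤ M ∧ ∀ x, |f x| ≤ M) ∧
      a < ∫ x, f x ∂μ + 1 - ∫ x, Real.exp (f x) ∂μ₀ := by
  rcases lt_or_ge a 0 with ha0 | ha0
  · exact ⟨fun _ => 0, measurable_const, ⟨0, le_rfl, by simp⟩, by simpa using ha0⟩
  by_cases hac : μ ≪ μ₀
  · set ρ : X → ℝ := fun x => (μ.rnDeriv μ₀ x).toReal with hρ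
    have hρm : Measurable ρ := (Measure.measurable_rnDeriv μ μ₀).ennreal_toReal
    set f : ℕ → X → ℝ := fun n x => truncLog n (ρ x) with hf
    have hfm : ∀ n, Measurable (f n) := fun n => (measurable_truncLog n).comp hρm
    have hfb : ∀ n x, |f n x| ≤ n := fun n x => abs_truncLog_le n _
    have hfi : ∀ n, Integrable (f n) μ := fun n =>
      .of_bound (hfm n).aestronglyMeasurable n (ae_of_all _ (hfb n))
    have hei : ∀ n, Integrable (fun x => Real.exp (f n x)) μ₀ := fun n =>
      .of_bound (hfm n).exp.aestronglyMeasurable (Real.exp n) (ae_of_all _ fun x => by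
        rw [Real.norm_eq_abs, Real.abs_exp]
        exact Real.exp_le_exp.2 ((le_abs_self _).trans (hfb n x)))
    have hρi : ∀ n, Integrable (fun x => ρ x * f n x) μ₀ := fun n =>
      (integrable_rnDeriv_smul_iff hac).2 (hfi n)
    -- Fatou's lemma along the truncations of the log-density.
    have hkl : InformationTheory.klDiv μ μ₀ ≤
        liminf (fun n => ∫⁻ x, ENNReal.ofReal (ρ x * f n x + 1 - Real.exp (f n x)) ∂μ₀) atTop := by
      rw [InformationTheory.klDiv_eq_lintegral_klFun_of_ac hac]
      refine le_trans (le_of_eq (lintegral_congr fun x => ?_)) (lintegral_liminf_le fun n =>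
        (((hρm.mul (hfm n)).add_const 1).sub (hfm n).exp).ennreal_ofReal)
      exact (((ENNReal.continuous_ofReal.tendsto _).comp
        (tendsto_mul_truncLog ENNReal.toReal_nonneg)).liminf_eq).symm
    have h1 : ENNReal.ofReal a < InformationTheory.klDiv μ μ₀ := by
      rw [← EReal.coe_ennreal_lt_coe_ennreal_iff, EReal.coe_ennreal_ofReal, max_eq_left ha0]
      exact ha
    obtain ⟨n, hn⟩ := (eventually_lt_of_lt_liminf (h1.trans_le hkl)).exists
    refine ⟨f n, hfm n, ⟨n, Nat.cast_nonneg n, hfb n⟩, ?_⟩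
    rw [← ofReal_integral_eq_lintegral_ofReal (f := fun x => ρ x * f n x + 1 - Real.exp (f n x))
      (((hρi n).add (integrable_const 1)).sub (hei n))
      (ae_of_all _ fun x => mul_truncLog_add_nonneg ENNReal.toReal_nonneg n)] at hn
    have h2 := ((ENNReal.ofReal_lt_ofReal_iff_of_nonneg ha0).1 hn)
    have h3 : ∫ x, (ρ x * f n x + 1 - Real.exp (f n x)) ∂μ₀ =
        ∫ x, f n x ∂μ + 1 - ∫ x, Real.exp (f n x) ∂μ₀ := by
      rw [integral_sub (f := fun x => ρ x * f n x + 1) ((hρi n).add (integrable_const 1)) (hei n),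
        integral_add (hρi n) (integrable_const 1), integral_const, probReal_univ, one_smul,
        ← integral_rnDeriv_smul hac]
      rfl
    rwa [h3] at h2
  · obtain ⟨A, hA, hA0, hA1⟩ : ∃ A, MeasurableSet A ∧ μ₀ A = 0 ∧ μ A ≠ 0 := by
      by_contra! hcon
      exact hac (Measure.AbsolutelyContinuous.mk hcon)
    have hpos : 0 < μ.real A := ENNReal.toReal_pos hA1 (measure_ne_top _ _)
    have ht : 0 ≤ (a + 1) / μ.real A := by positivity
    -- Singular case: the height is chosen so that the functional equals `a + 1`, because `μ₀` does
    -- not see `A`.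
    refine ⟨A.indicator fun _ => (a + 1) / μ.real A, measurable_const.indicator hA,
      ⟨(a + 1) / μ.real A, ht, fun x => ?_⟩, ?_⟩
    · by_cases hx : x ∈ A
      · simp [hx, abs_of_nonneg ht]
      · simp [hx, ht]
    · have h0 : ∫ x, Real.exp (A.indicator (fun _ => (a + 1) / μ.real A) x) ∂μ₀ = 1 := by
        rw [integral_congr_ae (g := fun _ => (1 : ℝ))]
        · simp
        · filter_upwards [measure_eq_zero_iff_ae_notMem.1 hA0] with x hx
          simp [hx]
      rw [h0, integral_indicator hA, setIntegral_const, smul_eq_mul, mul_div_cancel₀ _ hpos.ne']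
      linarith

/-- A continuous test function nearly attaining the relative entropy. -/
lemma exists_continuousMap_lt_of_lt_klDiv [TopologicalSpace X] [CompactSpace X]
    [TopologicalSpace.MetrizableSpace X] [BorelSpace X]
    {μ μ₀ : Measure X} [IsProbabilityMeasure μ]
    [IsProbabilityMeasure μ₀] {a : ℝ}
    (ha : (a : EReal) < ((InformationTheory.klDiv μ μ₀ : ℝ≥0∞) : EReal)) :
    ∃ f : C(X, ℝ), a < ∫ x, f x ∂μ + 1 - ∫ x, Real.exp (f x) ∂μ₀ := by
  obtain ⟨f, hfm, ⟨M, hM, hfM⟩, hf⟩ := exists_measurable_lt_of_lt_klDiv ha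
  set δ := (∫ x, f x ∂μ + 1 - ∫ x, Real.exp (f x) ∂μ₀) - a with hδ
  have hδ0 : 0 < δ := by rw [hδ]; linarith
  have hK : 0 < 1 + Real.exp M := by positivity
  -- The map `exp` is `exp M`-Lipschitz on `[-M, M]`, so replacing `f` by `g` costs at most `δ / 2`,
  -- half of the available gap.
  obtain ⟨g, hgM, hg⟩ := exists_continuousMap_integral_abs_sub_le (μ + μ₀) hfm hM hfM
    (show 0 < δ / (2 * (1 + Real.exp M)) by positivity)
  have hbd : ∀ (ν : Measure X) [IsFiniteMeasure ν], Integrable f ν := fun ν _ =>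
    .of_bound hfm.aestronglyMeasurable M (ae_of_all _ hfM)
  have hexp : ∀ h : X → ℝ, Measurable h → (∀ x, |h x| ≤ M) →
      Integrable (fun x => Real.exp (h x)) μ₀ := fun h hm hb =>
    .of_bound hm.exp.aestronglyMeasurable (Real.exp M) (ae_of_all _ fun x => by
      rw [Real.norm_eq_abs, Real.abs_exp]
      exact Real.exp_le_exp.2 ((le_abs_self _).trans (hb x)))
  have hsub : ∀ (ν : Measure X) [IsFiniteMeasure ν], Integrable (fun x => |f x - g x|) ν :=
    fun ν _ => ((hbd ν).sub (integrable_continuousMap ν g)).abs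
  rw [integral_add_measure (hsub μ) (hsub μ₀)] at hg
  have hnn : ∀ (ν : Measure X), 0 ≤ ∫ x, |f x - g x| ∂ν := fun ν =>
    integral_nonneg fun x => abs_nonneg _
  have h1 : ∫ x, f x ∂μ - ∫ x, g x ∂μ ≤ ∫ x, |f x - g x| ∂μ := by
    rw [← integral_sub (hbd μ) (integrable_continuousMap μ g)]
    exact integral_mono ((hbd μ).sub (integrable_continuousMap μ g)) (hsub μ)
      fun x => le_abs_self _
  have h2 : ∫ x, Real.exp (g x) ∂μ₀ - ∫ x, Real.exp (f x) ∂μ₀ ≤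
      Real.exp M * ∫ x, |f x - g x| ∂μ₀ := by
    have hge := hexp g (Continuous.measurable g.continuous) hgM
    rw [← integral_sub hge (hexp f hfm hfM), ← integral_const_mul]
    refine integral_mono (hge.sub (hexp f hfm hfM)) ((hsub μ₀).const_mul _) fun x => ?_
    have h3 := Real.add_one_le_exp (f x - g x)
    have h4 : Real.exp (f x) = Real.exp (g x) * Real.exp (f x - g x) := by
      rw [← Real.exp_add]; congr 1; ring
    have h5 : Real.exp (g x) ≤ Real.exp M :=
      Real.exp_le_exp.2 ((le_abs_self _).trans (hgM x))
    have h6 := Real.exp_pos (g x)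
    have h7 := neg_abs_le (f x - g x)
    have h8 := abs_nonneg (f x - g x)
    change Real.exp (g x) - Real.exp (f x) ≤ Real.exp M * |f x - g x|
    rw [h4]
    nlinarith
  have h9 : (1 + Real.exp M) * (∫ x, |f x - g x| ∂μ + ∫ x, |f x - g x| ∂μ₀) ≤ δ / 2 := by
    calc _ ≤ (1 + Real.exp M) * (δ / (2 * (1 + Real.exp M))) := by gcongr
      _ = δ / 2 := by field_simp
  refine ⟨g, ?_⟩
  nlinarith [hnn μ, hnn μ₀, Real.exp_pos M]

end Entropy

/-! ### Change of measure between product measures. -/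

section ChangeOfMeasure

variable {X : Type*} [MeasurableSpace X]

/-- The product is 1 where the density is positive and 0 where it vanishes, as `llr` takes the value
`log 0 = 0` there. Hence the later bounds are inequalities. -/
lemma rnDeriv_mul_exp_neg_llr_le (μ μ₀ : Measure X) [SigmaFinite μ] :
    ∀ᵐ x ∂μ₀, μ.rnDeriv μ₀ x * ENNReal.ofReal (Real.exp (-llr μ μ₀ x)) ≤ 1 := by
  filter_upwards [Measure.rnDeriv_lt_top μ μ₀] with x hx
  rcases eq_or_ne (μ.rnDeriv μ₀ x) 0 with h | h
  · simp [h]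
  · rw [llr_def, Real.exp_neg, Real.exp_log (ENNReal.toReal_pos h hx.ne),
      ENNReal.ofReal_inv_of_pos (ENNReal.toReal_pos h hx.ne), ENNReal.ofReal_toReal hx.ne,
      ENNReal.mul_inv_cancel h hx.ne]

lemma lintegral_pi_prod {ι : Type*} [Fintype ι] {Ω : Type*} [MeasurableSpace Ω] (P : Measure Ω)
    [IsProbabilityMeasure P] (f : ι → Ω → ℝ≥0∞) (hf : ∀ i, Measurable (f i)) :
    ∫⁻ x, ∏ i, f i (x i) ∂(Measure.pi fun _ : ι => P) = ∏ i, ∫⁻ ω, f i ω ∂P := by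
  rw [ProbabilityTheory.lintegral_prod_eq_prod_lintegral_of_indepFun Finset.univ
    (fun i (x : ι → Ω) => f i (x i)) (ProbabilityTheory.iIndepFun_pi fun i => (hf i).aemeasurable)
    fun i => (hf i).comp (measurable_pi_apply i)]
  exact Finset.prod_congr rfl fun i _ =>
    (measurePreserving_eval (fun _ : ι => P) i).lintegral_comp (hf i)

lemma pi_eq_withDensity_rnDeriv {ι : Type*} [Fintype ι] {μ μ₀ : Measure X} [IsProbabilityMeasure μ]
    [IsProbabilityMeasure μ₀] (hac : μ ≪ μ₀) :
    Measure.pi (fun _ : ι => μ) =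
      (Measure.pi fun _ : ι => μ₀).withDensity fun x => ∏ i, μ.rnDeriv μ₀ (x i) := by
  refine (Measure.pi_eq fun s hs => ?_)
  rw [withDensity_apply _ (MeasurableSet.univ_pi hs), ← lintegral_indicator (MeasurableSet.univ_pi hs)]
  have h1 : ∀ x : ι → X, (Set.univ.pi s).indicator (fun x => ∏ i, μ.rnDeriv μ₀ (x i)) x =
      ∏ i, (s i).indicator (μ.rnDeriv μ₀) (x i) := fun x => by
    by_cases hx : x ∈ Set.univ.pi s
    · rw [Set.indicator_of_mem hx]
      exact Finset.prod_congr rfl fun i _ => (Set.indicator_of_mem (hx i trivial) _).symm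
    · rw [Set.indicator_of_notMem hx]
      simp only [Set.mem_univ_pi, not_forall] at hx
      obtain ⟨i, hi⟩ := hx
      exact (Finset.prod_eq_zero (Finset.mem_univ i) (Set.indicator_of_notMem hi _)).symm
  simp_rw [h1]
  rw [lintegral_pi_prod μ₀ _ fun i => (Measure.measurable_rnDeriv μ μ₀).indicator (hs i)]
  refine Finset.prod_congr rfl fun i _ => ?_
  rw [lintegral_indicator (hs i), ← withDensity_apply _ (hs i), Measure.withDensity_rnDeriv_eq _ _ hac]

lemma lintegral_mul_exp_neg_sum_llr_le {ι : Type*} [Fintype ι] {μ μ₀ : Measure X}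
    [IsProbabilityMeasure μ] [IsProbabilityMeasure μ₀] (hac : μ ≪ μ₀) {F : (ι → X) → ℝ≥0∞}
    (hF : Measurable F) :
    ∫⁻ x, F x * ENNReal.ofReal (Real.exp (-∑ i, llr μ μ₀ (x i))) ∂(Measure.pi fun _ : ι => μ) ≤
      ∫⁻ x, F x ∂(Measure.pi fun _ : ι => μ₀) := by
  have hm : Measurable fun x : ι → X => ∏ i, μ.rnDeriv μ₀ (x i) :=
    Finset.measurable_prod _ fun i _ =>
      (Measure.measurable_rnDeriv μ μ₀).comp (measurable_pi_apply i)
  have hm' : Measurable fun x : ι → X => ∑ i, llr μ μ₀ (x i) :=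
    Finset.measurable_sum _ fun i _ => (measurable_llr μ μ₀).comp (measurable_pi_apply i)
  have hFm : Measurable fun x => F x * ENNReal.ofReal (Real.exp (-∑ i, llr μ μ₀ (x i))) :=
    hF.mul hm'.neg.exp.ennreal_ofReal
  rw [pi_eq_withDensity_rnDeriv hac, lintegral_withDensity_eq_lintegral_mul _ hm hFm]
  have hae : ∀ᵐ x ∂(Measure.pi fun _ : ι => μ₀), ∀ i,
      μ.rnDeriv μ₀ (x i) * ENNReal.ofReal (Real.exp (-llr μ μ₀ (x i))) ≤ 1 :=
    ae_all_iff.2 fun i => (measurePreserving_eval (fun _ : ι => μ₀) i).quasiMeasurePreserving.ae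
      (rnDeriv_mul_exp_neg_llr_le μ μ₀)
  refine lintegral_mono_ae (hae.mono fun x hx => ?_)
  have h2 : ENNReal.ofReal (Real.exp (-∑ i, llr μ μ₀ (x i))) =
      ∏ i, ENNReal.ofReal (Real.exp (-llr μ μ₀ (x i))) := by
    rw [← Finset.sum_neg_distrib, Real.exp_sum,
      ENNReal.ofReal_prod_of_nonneg fun i _ => (Real.exp_pos _).le]
  calc (∏ i, μ.rnDeriv μ₀ (x i)) * (F x * ENNReal.ofReal (Real.exp (-∑ i, llr μ μ₀ (x i))))
      = F x * ∏ i, (μ.rnDeriv μ₀ (x i) * ENNReal.ofReal (Real.exp (-llr μ μ₀ (x i)))) := by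
        rw [h2, Finset.prod_mul_distrib]; ring
    _ ≤ F x * 1 := by gcongr; exact Finset.prod_le_one' fun i _ => hx i
    _ = F x := mul_one _

lemma lintegral_prod_mul_exp_neg_llr_le {μ μ₀ : Measure X}
    [IsProbabilityMeasure μ] [IsProbabilityMeasure μ₀] (hac : μ ≪ μ₀) {F : X × X → ℝ≥0∞}
    (hF : Measurable F) :
    ∫⁻ p, F p * ENNReal.ofReal (Real.exp (-(llr μ μ₀ p.1 + llr μ μ₀ p.2))) ∂(μ.prod μ) ≤
      ∫⁻ p, F p ∂(μ₀.prod μ₀) := by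
  have h := lintegral_mul_exp_neg_sum_llr_le (ι := Fin 2) hac
    (hF.comp (MeasurableEquiv.finTwoArrow (α := X)).measurable)
  rw [← (measurePreserving_finTwoArrow μ₀).lintegral_comp hF]
  refine le_trans (le_of_eq ?_) h
  have hFm : Measurable fun p : X × X =>
      F p * ENNReal.ofReal (Real.exp (-(llr μ μ₀ p.1 + llr μ μ₀ p.2))) :=
    hF.mul (((measurable_llr μ μ₀).comp measurable_fst).add
      ((measurable_llr μ μ₀).comp measurable_snd)).neg.exp.ennreal_ofReal
  rw [← (measurePreserving_finTwoArrow μ).lintegral_comp hFm]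
  refine lintegral_congr fun x => ?_
  simp [Fin.sum_univ_two]

/-- The entropy inequality for the product of two copies of `μ`. -/
lemma integral_prod_le_of_lintegral_exp_le {μ μ₀ : Measure X}
    [IsProbabilityMeasure μ] [IsProbabilityMeasure μ₀] (hac : μ ≪ μ₀)
    (hllr : Integrable (llr μ μ₀) μ) {g : X × X → ℝ} (hg : Measurable g) (hg0 : ∀ p, 0 ≤ g p)
    {K : ℝ} (hK : 0 ≤ K)
    (hgK : ∫⁻ p, ENNReal.ofReal (Real.exp (g p)) ∂(μ₀.prod μ₀) ≤ ENNReal.ofReal K) :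
    Integrable g (μ.prod μ) ∧ ∫ p, g p ∂(μ.prod μ) ≤ 2 * ∫ x, llr μ μ₀ x ∂μ - 1 + K := by
  set s : X × X → ℝ := fun p => llr μ μ₀ p.1 + llr μ μ₀ p.2 with hs
  have hsm : Measurable s := ((measurable_llr μ μ₀).comp measurable_fst).add
      ((measurable_llr μ μ₀).comp measurable_snd)
  have h1 : Integrable (fun p : X × X => llr μ μ₀ p.1) (μ.prod μ) := hllr.comp_fst μ
  have h2 : Integrable (fun p : X × X => llr μ μ₀ p.2) (μ.prod μ) := hllr.comp_snd μ
  have hsi : Integrable s (μ.prod μ) := h1.add h2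
  have hsint : ∫ p, s p ∂(μ.prod μ) = 2 * ∫ x, llr μ μ₀ x ∂μ := by
    rw [hs, integral_add h1 h2, integral_fun_fst (llr μ μ₀), integral_fun_snd (llr μ μ₀)]
    simp; ring
  have hle : ∫⁻ p, ENNReal.ofReal (Real.exp (g p - s p)) ∂(μ.prod μ) ≤ ENNReal.ofReal K := by
    refine le_trans (le_trans (le_of_eq ?_)
      (lintegral_prod_mul_exp_neg_llr_le hac hg.exp.ennreal_ofReal)) hgK
    refine lintegral_congr fun p => ?_
    rw [← ENNReal.ofReal_mul (Real.exp_pos _).le, ← Real.exp_add, sub_eq_add_neg]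
  have hem : Measurable fun p => Real.exp (g p - s p) := (hg.sub hsm).exp
  have hei : Integrable (fun p => Real.exp (g p - s p)) (μ.prod μ) :=
    ⟨hem.aestronglyMeasurable, (hasFiniteIntegral_iff_ofReal
      (ae_of_all _ fun p => (Real.exp_pos _).le)).2 (hle.trans_lt ENNReal.ofReal_lt_top)⟩
  have heint : ∫ p, Real.exp (g p - s p) ∂(μ.prod μ) ≤ K := by
    rw [integral_eq_lintegral_of_nonneg_ae (ae_of_all _ fun p => (Real.exp_pos _).le)
      hem.aestronglyMeasurable]
    exact ENNReal.toReal_le_of_le_ofReal hK hle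
  -- The convexity inequality `u + 1 ≤ exp u` at `u = g - s`; its integral gives the entropy
  -- inequality, with no logarithm of `K`.
  have hpt : ∀ p, g p ≤ s p - 1 + Real.exp (g p - s p) := fun p => by
    linarith [Real.add_one_le_exp (g p - s p)]
  have hri : Integrable (fun p => s p - 1 + Real.exp (g p - s p)) (μ.prod μ) :=
    (hsi.sub (integrable_const 1)).add hei
  have hgi : Integrable g (μ.prod μ) := hri.mono' hg.aestronglyMeasurable
    (ae_of_all _ fun p => by rw [Real.norm_of_nonneg (hg0 p)]; exact hpt p)
  refine ⟨hgi, (integral_mono hgi hri hpt).trans ?_⟩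
  rw [integral_add (f := fun p => s p - 1) (hsi.sub (integrable_const 1)) hei,
    integral_sub hsi (integrable_const 1), hsint]
  simpa using heint

end ChangeOfMeasure

/-! ### Approximation in exponential moments. -/

/-- A function all of whose exponential moments are finite is approximated by continuous functions
in the sense of exponential moments. -/
lemma exists_continuousMap_lintegral_exp_le_two {Y : Type*} [TopologicalSpace Y] [CompactSpace Y]
    [TopologicalSpace.MetrizableSpace Y] [MeasurableSpace Y] [BorelSpace Y] (ν : Measure Y)
    [IsProbabilityMeasure ν] {w : Y → ℝ} (hw : Measurable w)
    (hexp : ∀ t : ℝ, Integrable (fun y => Real.exp (t * |w y|)) ν) {t : ℝ} (ht : 0 < t) :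
    ∃ v : C(Y, ℝ), ∫⁻ y, ENNReal.ofReal (Real.exp (t * |w y - v y|)) ∂ν ≤ 2 := by
  set wt : ℕ → Y → ℝ := fun n y => max (-(n : ℝ)) (min n (w y)) with hwt
  have hwtm : ∀ n, Measurable (wt n) := fun n => measurable_const.max (measurable_const.min hw)
  have habs : ∀ n y, |w y - wt n y| ≤ |w y| := fun n y => by
    have hn : (0 : ℝ) ≤ n := Nat.cast_nonneg n
    have h3 := abs_le.1 (le_refl |w y|)
    rw [abs_le]
    rcases max_cases (-(n : ℝ)) (min n (w y)) with ⟨h1, h2⟩ | ⟨h1, h2⟩ <;>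
      rcases min_cases (n : ℝ) (w y) with ⟨h4, h5⟩ | ⟨h4, h5⟩ <;>
      simp only [hwt, h1, h4] at * <;> constructor <;> linarith [h3.1, h3.2]
  -- First stage: truncation. The exponent is doubled because the two stages are later combined by
  -- `ab ≤ (a² + b²) / 2`.
  have hlim : Tendsto (fun n => ∫ y, Real.exp (2 * t * |w y - wt n y|) ∂ν) atTop (𝓝 1) := by
    have h1 : (1 : ℝ) = ∫ _y, (1 : ℝ) ∂ν := by simp
    rw [h1]
    refine tendsto_integral_of_dominated_convergence (fun y => Real.exp (2 * t * |w y|))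
      (fun n => ((hw.sub (hwtm n)).abs.const_mul _).exp.aestronglyMeasurable) (hexp _)
      (fun n => ae_of_all _ fun y => ?_) (ae_of_all _ fun y => ?_)
    · rw [Real.norm_eq_abs, Real.abs_exp]
      exact Real.exp_le_exp.2 (by have := habs n y; gcongr)
    · have h2 : Tendsto (fun n => Real.exp (2 * t * |w y - wt n y|)) atTop
          (𝓝 (Real.exp (2 * t * |w y - w y|))) :=
        (Real.continuous_exp.tendsto _).comp
          (((tendsto_clamp (w y)).const_sub _).abs.const_mul _)
      simpa using h2
  obtain ⟨n, hn⟩ := (hlim.eventually (gt_mem_nhds one_lt_two)).exists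
  -- Second stage: both `wt n` and `v` lie in `[-n, n]`, so `E` bounds `exp (2 t |wt n - v|)` and
  -- serves as its slope in a linear bound. The `L¹` tolerance makes that stage contribute at most
  -- 2, and `2/2 + 2/2 = 2`.
  set E := Real.exp (4 * t * n) with hE
  have hEpos : 0 < E := Real.exp_pos _
  obtain ⟨v, hvM, hv⟩ := exists_continuousMap_integral_abs_sub_le ν (hwtm n) (Nat.cast_nonneg n)
    (fun y => abs_clamp_le (Nat.cast_nonneg n) _) (show 0 < 1 / (2 * t * E) by positivity)
  refine ⟨v, ?_⟩
  have hvm : Measurable v := Continuous.measurable v.continuous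
  have hwb : ∀ y, |wt n y - v y| ≤ 2 * n := fun y => by
    have h1 : |wt n y| ≤ n := abs_clamp_le (Nat.cast_nonneg n) _
    linarith [abs_sub (wt n y) (v y), hvM y]
  have hi1 : Integrable (fun y => |wt n y - v y|) ν :=
    .of_bound ((hwtm n).sub hvm).abs.aestronglyMeasurable (2 * n) (ae_of_all _ fun y => by
      simpa using hwb y)
  have hi2 : Integrable (fun y => Real.exp (2 * t * |w y - wt n y|)) ν :=
    (hexp (2 * t)).mono' ((hw.sub (hwtm n)).abs.const_mul _).exp.aestronglyMeasurable
      (ae_of_all _ fun y => by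
        rw [Real.norm_eq_abs, Real.abs_exp]
        exact Real.exp_le_exp.2 (by have := habs n y; gcongr))
  have hpt : ∀ y, Real.exp (t * |w y - v y|) ≤
      Real.exp (2 * t * |w y - wt n y|) / 2 + (1 + 2 * t * E * |wt n y - v y|) / 2 := fun y => by
    have h1 : Real.exp (2 * t * |wt n y - v y|) ≤ 1 + 2 * t * E * |wt n y - v y| := by
      set u := 2 * t * |wt n y - v y| with hu
      have hu0 : 0 ≤ u := by positivity
      have huE : Real.exp u ≤ E := Real.exp_le_exp.2 (by rw [hu]; nlinarith [hwb y])
      have h2 := Real.add_one_le_exp (-u)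
      have h3 : Real.exp u * Real.exp (-u) = 1 := by rw [← Real.exp_add]; simp
      have h4 : 2 * t * E * |wt n y - v y| = u * E := by rw [hu]; ring
      rw [h4]
      nlinarith [Real.exp_pos u]
    have h2 : Real.exp (t * |w y - v y|) ≤
        Real.exp (t * |w y - wt n y|) * Real.exp (t * |wt n y - v y|) := by
      rw [← Real.exp_add, ← mul_add]
      have := abs_sub_le (w y) (wt n y) (v y)
      exact Real.exp_le_exp.2 (by gcongr)
    have h3 : Real.exp (2 * t * |w y - wt n y|) = Real.exp (t * |w y - wt n y|) ^ 2 := by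
      rw [← Real.exp_nat_mul]; congr 1; push_cast; ring
    have h4 : Real.exp (2 * t * |wt n y - v y|) = Real.exp (t * |wt n y - v y|) ^ 2 := by
      rw [← Real.exp_nat_mul]; congr 1; push_cast; ring
    rw [h4] at h1
    rw [h3]
    nlinarith [sq_nonneg (Real.exp (t * |w y - wt n y|) - Real.exp (t * |wt n y - v y|))]
  have hi3 : Integrable (fun y => (1 + 2 * t * E * |wt n y - v y|) / 2) ν :=
    ((integrable_const 1).add (hi1.const_mul _)).div_const 2
  have hri : Integrable (fun y => Real.exp (2 * t * |w y - wt n y|) / 2 +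
      (1 + 2 * t * E * |wt n y - v y|) / 2) ν :=
    (hi2.div_const 2).add hi3
  calc ∫⁻ y, ENNReal.ofReal (Real.exp (t * |w y - v y|)) ∂ν
      ≤ ∫⁻ y, ENNReal.ofReal (Real.exp (2 * t * |w y - wt n y|) / 2 +
          (1 + 2 * t * E * |wt n y - v y|) / 2) ∂ν :=
        lintegral_mono fun y => ENNReal.ofReal_le_ofReal (hpt y)
    _ = ENNReal.ofReal (∫ y, (Real.exp (2 * t * |w y - wt n y|) / 2 +
          (1 + 2 * t * E * |wt n y - v y|) / 2) ∂ν) :=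
        (ofReal_integral_eq_lintegral_ofReal hri (ae_of_all _ fun y => by positivity)).symm
    _ ≤ ENNReal.ofReal 2 := by
        refine ENNReal.ofReal_le_ofReal ?_
        rw [integral_add (hi2.div_const 2) hi3, integral_div, integral_div,
          integral_add (integrable_const 1) (hi1.const_mul _), integral_const_mul]
        have h5 : 2 * t * E * ∫ y, |wt n y - v y| ∂ν ≤ 1 := by
          calc _ ≤ 2 * t * E * (1 / (2 * t * E)) := by gcongr
            _ = 1 := by field_simp
        simp only [integral_const, probReal_univ, smul_eq_mul, mul_one]
        linarith
    _ = 2 := by simp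

/-! ### Independent coordinates and decoupling of pair sums. -/

section Reindexing

variable {X : Type*} [MeasurableSpace X] {ι κ : Type*} [Fintype ι] [Fintype κ]
  (μ : Measure X) [IsProbabilityMeasure μ]

lemma measurePreserving_pi_comp_of_injective {e : κ → ι} (he : Function.Injective e) :
    MeasurePreserving (fun (x : ι → X) (k : κ) => x (e k)) (Measure.pi fun _ => μ)
      (Measure.pi fun _ => μ) := by
  refine ⟨measurable_pi_lambda _ fun k => measurable_pi_apply _, ?_⟩
  have h := (ProbabilityTheory.iIndepFun_pi (μ := fun _ : ι => μ) (X := fun _ x => x)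
    fun i => aemeasurable_id).precomp he
  rw [ProbabilityTheory.iIndepFun_iff_map_fun_eq_pi_map
    fun k => (measurable_pi_apply (e k)).aemeasurable] at h
  refine h.trans (congrArg _ (funext fun k => ?_))
  exact (measurePreserving_eval (fun _ : ι => μ) (e k)).map_eq

lemma measurePreserving_pi_pairs {e : κ ⊕ κ → ι} (he : Function.Injective e) :
    MeasurePreserving (fun (x : ι → X) (k : κ) => (x (e (.inl k)), x (e (.inr k))))
      (Measure.pi fun _ => μ) (Measure.pi fun _ => μ.prod μ) := by
  have h1 := measurePreserving_pi_comp_of_injective μ he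
  have h2 := (measurePreserving_sumPiEquivProdPi_symm (fun _ : κ ⊕ κ => μ)).symm
  have h3 := (measurePreserving_arrowProdEquivProdArrow X X κ (fun _ => μ) (fun _ => μ)).symm
  exact h3.comp (h2.comp h1)

lemma measurePreserving_pi_pair {i j : ι} (hij : i ≠ j) :
    MeasurePreserving (fun x : ι → X => (x i, x j)) (Measure.pi fun _ => μ) (μ.prod μ) := by
  have he : Function.Injective ![i, j] := by
    intro a b hab
    fin_cases a <;> fin_cases b <;> simp_all [hij.symm]
  exact (measurePreserving_finTwoArrow μ).comp (measurePreserving_pi_comp_of_injective μ he)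

end Reindexing

/-- Permutations act transitively on ordered pairs of distinct indices, so averaging one such pair
over permutations equals averaging over all pairs. -/
lemma sum_perm_mul_eq_sum_offDiag {ι : Type*} [Fintype ι] [DecidableEq ι] (F : ι → ι → ℝ)
    {a b : ι} (hab : a ≠ b) :
    ((Finset.univ : Finset ι).offDiag.card : ℝ) * ∑ σ : Equiv.Perm ι, F (σ a) (σ b) =
      (Fintype.card (Equiv.Perm ι) : ℝ) * ∑ p ∈ (Finset.univ : Finset ι).offDiag, F p.1 p.2 := by
  have h1 : ∀ p ∈ (Finset.univ : Finset ι).offDiag,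
      ∑ σ : Equiv.Perm ι, F (σ p.1) (σ p.2) = ∑ σ : Equiv.Perm ι, F (σ a) (σ b) := by
    rintro ⟨c, d⟩ hp
    have hcd : c ≠ d := (Finset.mem_offDiag.1 hp).2.2
    -- A permutation sending `(a, b)` to `(c, d)`.
    set τ : Equiv.Perm ι := Equiv.swap (Equiv.swap a c b) d * Equiv.swap a c with hτ
    have hb : Equiv.swap a c b ≠ c := fun h =>
      hab ((Equiv.swap a c).injective ((Equiv.swap_apply_left a c).trans h.symm))
    have ha' : τ a = c := by
      simp [hτ, Equiv.swap_apply_of_ne_of_ne hb.symm hcd]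
    have hb' : τ b = d := by simp [hτ]
    rw [← Equiv.sum_comp (Equiv.mulRight τ) fun σ : Equiv.Perm ι => F (σ a) (σ b)]
    simp [ha', hb']
  have h2 : ∀ σ : Equiv.Perm ι, ∑ p ∈ (Finset.univ : Finset ι).offDiag, F (σ p.1) (σ p.2) =
      ∑ p ∈ (Finset.univ : Finset ι).offDiag, F p.1 p.2 := fun σ =>
    Finset.sum_equiv (Equiv.prodCongr σ σ) (by simp) (by simp)
  calc _ = ∑ p ∈ (Finset.univ : Finset ι).offDiag, ∑ σ : Equiv.Perm ι, F (σ p.1) (σ p.2) := by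
        rw [Finset.sum_congr rfl h1, Finset.sum_const, nsmul_eq_mul]
    _ = ∑ σ : Equiv.Perm ι, ∑ p ∈ (Finset.univ : Finset ι).offDiag, F p.1 p.2 := by
        rw [Finset.sum_comm, Finset.sum_congr rfl fun σ _ => h2 σ]
    _ = _ := by simp [Finset.sum_const]

/-- Decoupling: the exponential moment of a mean field pair sum is bounded by that of a sum over
disjoint pairs. -/
theorem lintegral_exp_pairSum_le {X : Type*} [MeasurableSpace X] (μ₀ : Measure X)
    [IsProbabilityMeasure μ₀] {g : X × X → ℝ} (hg : Measurable g) (hg0 : ∀ p, 0 ≤ g p) (N : ℕ) :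
    ∫⁻ x, ENNReal.ofReal (Real.exp ((N : ℝ)⁻¹ *
        ∑ p ∈ (Finset.univ : Finset (Fin N)).offDiag, g (x p.1, x p.2)))
        ∂(Measure.pi fun _ : Fin N => μ₀) ≤
      (∫⁻ p, ENNReal.ofReal (Real.exp (2 * g p)) ∂(μ₀.prod μ₀)) ^ (N / 2) := by
  -- Below two particles there are no pairs and the power is 0, so both sides are 1.
  rcases lt_or_ge N 2 with hN | hN
  · have h0 : (Finset.univ : Finset (Fin N)).offDiag = ∅ := by
      have : Subsingleton (Fin N) := Fin.subsingleton_iff_le_one.2 (by omega)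
      ext ⟨a, b⟩
      simp [Subsingleton.elim a b]
    simp [h0, Nat.div_eq_of_lt hN]
  set k := N / 2 with hk
  have hk1 : 1 ≤ k := by omega
  -- The disjoint pairs `(2l, 2l + 1)`; for odd `N` the last index is left out.
  let e : Fin k ⊕ Fin k → Fin N :=
    Sum.elim (fun l => ⟨2 * l, by omega⟩) (fun l => ⟨2 * l + 1, by omega⟩)
  have he : Function.Injective e := by
    rintro (a | a) (b | b) hab <;> simp only [e, Sum.elim_inl, Sum.elim_inr, Fin.mk.injEq] at hab
    · exact congrArg _ (Fin.ext (by omega))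
    · omega
    · omega
    · exact congrArg _ (Fin.ext (by omega))
  set A : Equiv.Perm (Fin N) → (Fin N → X) → ℝ := fun σ x =>
    ∑ l : Fin k, g (x (σ (e (.inl l))), x (σ (e (.inr l)))) with hA
  have hA0 : ∀ σ x, 0 ≤ A σ x := fun σ x => Finset.sum_nonneg fun l _ => hg0 _
  set P : ℝ := (Fintype.card (Equiv.Perm (Fin N)) : ℝ) with hP
  have hPpos : 0 < P := by rw [hP]; exact_mod_cast Fintype.card_pos
  have hNR : (2 : ℝ) ≤ N := by exact_mod_cast hN
  have hkR : (1 : ℝ) ≤ k := by exact_mod_cast hk1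
  have hNk : (N : ℝ) - 1 ≤ 2 * k := by
    have : N ≤ 2 * k + 1 := by omega
    have : (N : ℝ) ≤ 2 * k + 1 := by exact_mod_cast this
    linarith
  have hcard : (((Finset.univ : Finset (Fin N)).offDiag.card : ℕ) : ℝ) = N * (N - 1) := by
    rw [Finset.offDiag_card, Finset.card_univ, Fintype.card_fin,
      Nat.cast_sub (Nat.le_mul_self N)]
    push_cast; ring
  have hsum : ∀ x : Fin N → X, (N : ℝ)⁻¹ *
      ∑ p ∈ (Finset.univ : Finset (Fin N)).offDiag, g (x p.1, x p.2) ≤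
      ∑ σ : Equiv.Perm (Fin N), P⁻¹ * (2 * A σ x) := fun x => by
    set S := ∑ p ∈ (Finset.univ : Finset (Fin N)).offDiag, g (x p.1, x p.2) with hS
    have h1 : (N : ℝ) * (N - 1) * ∑ σ : Equiv.Perm (Fin N), A σ x = k * (P * S) := by
      simp only [hA]
      rw [Finset.sum_comm, Finset.mul_sum]
      have h2 : ∀ l ∈ (Finset.univ : Finset (Fin k)), (N : ℝ) * (N - 1) *
          ∑ σ : Equiv.Perm (Fin N), g (x (σ (e (.inl l))), x (σ (e (.inr l)))) = P * S :=
        fun l _ => by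
          rw [← hcard]
          exact sum_perm_mul_eq_sum_offDiag (fun i j => g (x i, x j))
            (fun h => by simpa using he h)
      rw [Finset.sum_congr rfl h2]
      simp
    set T := ∑ σ : Equiv.Perm (Fin N), A σ x with hT
    have hT0 : 0 ≤ T := Finset.sum_nonneg fun σ _ => hA0 σ x
    rw [← Finset.mul_sum, ← Finset.mul_sum]
    have h3 : (N : ℝ)⁻¹ * S = P⁻¹ * ((N - 1) / k * T) := by
      have : (N : ℝ) ≠ 0 := by positivity
      field_simp
      linarith
    rw [h3]
    -- Permutation averaging produces the factor `(N - 1) / k`, which is at most 2 since `N ≤ 2k +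
    -- 1`. Replacing it by 2 uses `g ≥ 0`.
    have h4 : ((N : ℝ) - 1) / k ≤ 2 := by rw [div_le_iff₀ (by linarith)]; linarith
    gcongr
  have hAm : ∀ σ, Measurable (A σ) := fun σ => Finset.measurable_sum _ fun l _ =>
    hg.comp ((measurable_pi_apply _).prodMk (measurable_pi_apply _))
  have hint : ∀ σ, ∫⁻ x, ENNReal.ofReal (Real.exp (2 * A σ x)) ∂(Measure.pi fun _ : Fin N => μ₀) =
      (∫⁻ p, ENNReal.ofReal (Real.exp (2 * g p)) ∂(μ₀.prod μ₀)) ^ k := fun σ => by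
    have hgm : Measurable fun p => ENNReal.ofReal (Real.exp (2 * g p)) :=
      (hg.const_mul 2).exp.ennreal_ofReal
    have h1 := lintegral_pi_prod (ι := Fin k) (μ₀.prod μ₀) (fun _ p => ENNReal.ofReal (Real.exp (2 * g p)))
      (fun _ => hgm)
    have h2 := (measurePreserving_pi_pairs μ₀ (e := fun s => σ (e s))
      (σ.injective.comp he)).lintegral_comp (f := fun y : Fin k → X × X =>
        ∏ l, ENNReal.ofReal (Real.exp (2 * g (y l))))
      (Finset.measurable_prod _ fun l _ => hgm.comp (measurable_pi_apply l))
    rw [h1] at h2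
    simp only [Finset.prod_const, Finset.card_univ, Fintype.card_fin] at h2
    rw [← h2]
    refine lintegral_congr fun x => ?_
    rw [← ENNReal.ofReal_prod_of_nonneg fun l _ => (Real.exp_pos _).le, ← Real.exp_sum,
      hA, Finset.mul_sum]
  calc _ ≤ ∫⁻ x, ∑ σ : Equiv.Perm (Fin N), ENNReal.ofReal P⁻¹ *
          ENNReal.ofReal (Real.exp (2 * A σ x)) ∂(Measure.pi fun _ : Fin N => μ₀) := by
        refine lintegral_mono fun x => ?_
        -- Jensen's inequality for the uniform average over permutations.
        have h1 := convexOn_exp.map_sum_le (t := (Finset.univ : Finset (Equiv.Perm (Fin N))))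
          (w := fun _ => P⁻¹) (p := fun σ => 2 * A σ x) (fun _ _ => by positivity)
          (by simp [hP]) (fun _ _ => Set.mem_univ _)
        simp only [smul_eq_mul] at h1
        calc _ ≤ ENNReal.ofReal (∑ σ : Equiv.Perm (Fin N), P⁻¹ * Real.exp (2 * A σ x)) :=
              ENNReal.ofReal_le_ofReal ((Real.exp_le_exp.2 (hsum x)).trans h1)
          _ = _ := by
              rw [ENNReal.ofReal_sum_of_nonneg fun σ _ => by positivity]
              exact Finset.sum_congr rfl fun σ _ => ENNReal.ofReal_mul (by positivity)
    _ = ∑ σ : Equiv.Perm (Fin N), ENNReal.ofReal P⁻¹ *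
          (∫⁻ p, ENNReal.ofReal (Real.exp (2 * g p)) ∂(μ₀.prod μ₀)) ^ k := by
        rw [lintegral_finsetSum _ fun σ _ => ((hAm σ).const_mul 2).exp.ennreal_ofReal.const_mul _]
        refine Finset.sum_congr rfl fun σ _ => ?_
        rw [lintegral_const_mul _ ((hAm σ).const_mul 2).exp.ennreal_ofReal, hint σ]
    _ = _ := by
        rw [Finset.sum_const, nsmul_eq_mul, ← mul_assoc, Finset.card_univ,
          ENNReal.ofReal_inv_of_pos hPpos, hP, ENNReal.ofReal_natCast,
          ENNReal.mul_inv_cancel (by exact_mod_cast Fintype.card_ne_zero) (ENNReal.natCast_ne_top _),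
          one_mul]

/-! ### Empirical measures. -/

section EmpiricalMeasure

variable {X : Type*} [MeasurableSpace X]

lemma coe_empiricalMeasure (N : ℕ+) (x : Fin N → X) :
    (empiricalMeasure N x : Measure X) = ((N : ℕ) : ℝ≥0∞)⁻¹ • ∑ i, Measure.dirac (x i) := rfl

lemma measurable_empiricalMeasure (N : ℕ+) :
    Measurable (empiricalMeasure N : (Fin N → X) → ProbabilityMeasure X) := by
  refine Measurable.subtype_mk (Measure.measurable_of_measurable_coe _ fun s hs => ?_)
  simp only [Measure.smul_apply, Measure.finsetSum_apply, smul_eq_mul]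
  refine (Finset.measurable_sum _ fun i _ => ?_).const_mul _
  exact (Measure.measurable_coe hs).comp (Measure.measurable_dirac.comp (measurable_pi_apply i))

lemma integral_empiricalMeasure (N : ℕ+) (x : Fin N → X) {f : X → ℝ} (hf : StronglyMeasurable f) :
    ∫ y, f y ∂(empiricalMeasure N x : Measure X) = (N : ℝ)⁻¹ * ∑ i, f (x i) := by
  rw [coe_empiricalMeasure, integral_smul_measure, integral_finsetSum_measure fun i _ =>
    integrable_dirac' hf (by simp)]
  simp [integral_dirac' f _ hf]

end EmpiricalMeasure

/-! ### Upper estimates through continuous test functionals. -/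

section Continuous

variable {X : Type*} [TopologicalSpace X] [CompactSpace X] [TopologicalSpace.MetrizableSpace X]
  [MeasurableSpace X] [BorelSpace X]

lemma measurable_integral_continuousMap {Y : Type*} [TopologicalSpace Y] [CompactSpace Y]
    [MeasurableSpace Y] [OpensMeasurableSpace Y] (f : C(Y, ℝ)) :
    Measurable fun ν : ProbabilityMeasure Y => ∫ y, f y ∂(ν : Measure Y) := by
  have hf : Measurable f := Continuous.measurable f.continuous
  have h : (fun ν : ProbabilityMeasure Y => ∫ y, f y ∂(ν : Measure Y)) =
      fun ν : ProbabilityMeasure Y =>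
      (∫⁻ y, ENNReal.ofReal (f y) ∂(ν : Measure Y)).toReal -
        (∫⁻ y, ENNReal.ofReal (-f y) ∂(ν : Measure Y)).toReal := by
    ext ν
    exact integral_eq_lintegral_pos_part_sub_lintegral_neg_part (integrable_continuousMap _ f)
  rw [h]
  exact ((Measure.measurable_lintegral hf.ennreal_ofReal).comp
    measurable_subtype_coe).ennreal_toReal.sub
    ((Measure.measurable_lintegral hf.neg.ennreal_ofReal).comp
    measurable_subtype_coe).ennreal_toReal

lemma integral_prod_empiricalMeasure (N : ℕ+) (x : Fin N → X) (v : C(X × X, ℝ)) :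
    ∫ p, v p ∂((empiricalMeasure N x : Measure X).prod (empiricalMeasure N x : Measure X)) =
      (N : ℝ)⁻¹ * ((N : ℝ)⁻¹ * ∑ i, ∑ j, v (x i, x j)) := by
  rw [integral_prod _ (integrable_continuousMap _ v)]
  have h : ∀ y, ∫ z, v (y, z) ∂(empiricalMeasure N x : Measure X) =
      (N : ℝ)⁻¹ * ∑ j, v (y, x j) := fun y =>
    integral_empiricalMeasure N x (f := fun z => v (y, z))
      (Continuous.stronglyMeasurable (by fun_prop))
  simp_rw [h]
  rw [integral_empiricalMeasure N x (f := fun y => (N : ℝ)⁻¹ * ∑ j, v (y, x j))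
    (Continuous.stronglyMeasurable (by fun_prop)), ← Finset.mul_sum]

/-- The sum of `w` over the ordered pairs of distinct coordinates of `x`. -/
def pairSum {X : Type*} (w : X × X → ℝ) (N : ℕ) (x : Fin N → X) : ℝ :=
  ∑ p ∈ (Finset.univ : Finset (Fin N)).offDiag, w (x p.1, x p.2)

lemma measurable_pairSum {X : Type*} [MeasurableSpace X] {w : X × X → ℝ} (hw : Measurable w)
    (N : ℕ) : Measurable (pairSum w N) :=
  Finset.measurable_sum _ fun _ _ =>
    hw.comp ((measurable_pi_apply _).prodMk (measurable_pi_apply _))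

lemma pairSum_eq_sub {X : Type*} (w : X × X → ℝ) (N : ℕ) (x : Fin N → X) :
    pairSum w N x = ∑ i, ∑ j, w (x i, x j) - ∑ i, w (x i, x i) := by
  have h1 := Finset.sum_union (f := fun p : Fin N × Fin N => w (x p.1, x p.2))
    (Finset.disjoint_diag_offDiag (Finset.univ : Finset (Fin N)))
  rw [Finset.diag_union_offDiag, Finset.sum_product, Finset.sum_diag] at h1
  rw [h1, pairSum]
  ring

/-- The diagonal absent from the pair sum is an average of `v (x_i, x_i)`, bounded by `‖v‖` and
negligible against `N`. -/
lemma inv_mul_pairSum_eq (N : ℕ+) (x : Fin N → X) (v : C(X × X, ℝ)) :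
    (N : ℝ)⁻¹ * pairSum v N x =
      N * ∫ p, v p ∂((empiricalMeasure N x : Measure X).prod (empiricalMeasure N x : Measure X)) -
        (N : ℝ)⁻¹ * ∑ i, v (x i, x i) := by
  have hN : ((N : ℕ) : ℝ) ≠ 0 := by exact_mod_cast N.pos.ne'
  rw [integral_prod_empiricalMeasure, pairSum_eq_sub]
  field_simp

lemma abs_inv_mul_sum_le {X : Type*} [TopologicalSpace X] [CompactSpace X] (N : ℕ+)
    (x : Fin N → X) (v : C(X × X, ℝ)) :
    |(N : ℝ)⁻¹ * ∑ i, v (x i, x i)| ≤ ‖v‖ := by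
  have hN : ((N : ℕ) : ℝ) ≠ 0 := by exact_mod_cast N.pos.ne'
  rw [abs_mul, abs_of_nonneg (by positivity)]
  calc (N : ℝ)⁻¹ * |∑ i, v (x i, x i)| ≤ (N : ℝ)⁻¹ * ∑ i : Fin N, ‖v‖ := by
        gcongr
        exact (Finset.abs_sum_le_sum_abs _ _).trans
          (Finset.sum_le_sum fun i _ => v.norm_coe_le_norm _)
    _ = ‖v‖ := by simp [hN]

/-- The exponential Chebyshev inequality for empirical measures. -/
lemma measure_empiricalMeasure_le {X : Type*} [TopologicalSpace X] [CompactSpace X]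
    [MeasurableSpace X] [BorelSpace X] (μ₀ : Measure X) [IsProbabilityMeasure μ₀] (f : C(X, ℝ)) (b : ℝ)
    (N : ℕ+) :
    (Measure.pi fun _ : Fin N => μ₀) {x | b < ∫ y, f y ∂(empiricalMeasure N x : Measure X) + 1 -
      ∫ y, Real.exp (f y) ∂μ₀} ≤ ENNReal.ofReal (Real.exp (-(N * b))) := by
  set K := ∫ y, Real.exp (f y) ∂μ₀ with hK
  have hN : (0 : ℝ) < ((N : ℕ) : ℝ) := by exact_mod_cast N.pos
  have hfm : Measurable f := Continuous.measurable f.continuous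
  have hK0 : 0 ≤ K := integral_nonneg fun y => (Real.exp_pos _).le
  have hKe : ∫⁻ y, ENNReal.ofReal (Real.exp (f y)) ∂μ₀ = ENNReal.ofReal K :=
    (ofReal_integral_eq_lintegral_ofReal
      (integrable_continuousMap μ₀ ⟨fun y => Real.exp (f y), by fun_prop⟩)
      (ae_of_all _ fun y => (Real.exp_pos _).le)).symm
  set F : (Fin N → X) → ℝ≥0∞ := fun x => ENNReal.ofReal (Real.exp (-(N * (b - 1 + K)))) *
    ∏ i, ENNReal.ofReal (Real.exp (f (x i))) with hF
  have hprod : Measurable fun x : Fin N → X => ∏ i, ENNReal.ofReal (Real.exp (f (x i))) :=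
    Finset.measurable_prod _ fun i _ => (hfm.comp (measurable_pi_apply i)).exp.ennreal_ofReal
  have hFm : Measurable F := hprod.const_mul _
  refine (meas_le_lintegral₀ hFm.aemeasurable fun x hx => ?_).trans ?_
  · have hx' : b < (N : ℝ)⁻¹ * ∑ i, f (x i) + 1 - K := by
      rw [← integral_empiricalMeasure N x hfm.stronglyMeasurable]; exact hx
    rw [hF]
    beta_reduce
    rw [← ENNReal.ofReal_prod_of_nonneg fun i _ => (Real.exp_pos _).le, ← Real.exp_sum,
      ← ENNReal.ofReal_mul (Real.exp_pos _).le, ← Real.exp_add, ENNReal.one_le_ofReal,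
      Real.one_le_exp_iff]
    have h1 : (N : ℝ) * (b - 1 + K) ≤ (N : ℝ) * ((N : ℝ)⁻¹ * ∑ i, f (x i)) := by
      gcongr; linarith
    rw [mul_inv_cancel_left₀ hN.ne'] at h1
    linarith
  · rw [hF, lintegral_const_mul _ hprod, lintegral_pi_prod μ₀
      (fun _ y => ENNReal.ofReal (Real.exp (f y))) fun _ => hfm.exp.ennreal_ofReal]
    simp only [hKe, Finset.prod_const, Finset.card_univ, Fintype.card_fin]
    rw [← ENNReal.ofReal_pow hK0, ← ENNReal.ofReal_mul (Real.exp_pos _).le]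
    refine ENNReal.ofReal_le_ofReal ?_
    -- This is why `1 - ∫ exp f` can stand in place of `-log ∫ exp f`.
    have h1 : K ≤ Real.exp (K - 1) := by linarith [Real.add_one_le_exp (K - 1)]
    calc Real.exp (-(N * (b - 1 + K))) * K ^ (N : ℕ)
        ≤ Real.exp (-(N * (b - 1 + K))) * Real.exp (K - 1) ^ (N : ℕ) := by gcongr
      _ = Real.exp (-(N * b)) := by
          rw [← Real.exp_nat_mul, ← Real.exp_add]; congr 1; ring

/-- The set of measures on which two test functionals are bounded below. -/
def testSet (μ₀ : Measure X) (β : ℝ) (f : C(X, ℝ)) (v : C(X × X, ℝ)) (b c : ℝ) :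
    Set (ProbabilityMeasure X) :=
  {ν | b < ∫ y, f y ∂(ν : Measure X) + 1 - ∫ y, Real.exp (f y) ∂μ₀ ∧
    c < β * ∫ p, v p ∂((ν : Measure X).prod (ν : Measure X))}

lemma isOpen_testSet (μ₀ : Measure X) (β : ℝ) (f : C(X, ℝ)) (v : C(X × X, ℝ)) (b c : ℝ) :
    IsOpen (testSet μ₀ β f v b c) := by
  have h1 : Continuous fun ν : ProbabilityMeasure X => ∫ y, f y ∂(ν : Measure X) :=
    ProbabilityMeasure.continuous_integral_continuousMap f
  have h2 : Continuous fun ν : ProbabilityMeasure X =>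
      ∫ p, v p ∂((ν.prod ν : ProbabilityMeasure (X × X)) : Measure (X × X)) :=
    (ProbabilityMeasure.continuous_integral_continuousMap v).comp
      (ProbabilityMeasure.continuous_prod.comp (continuous_id.prodMk continuous_id))
  exact (isOpen_lt continuous_const ((h1.add_const 1).sub continuous_const)).inter
    (isOpen_lt continuous_const (h2.const_mul β))

/-- The σ-algebra on `P(X)` comes from evaluations on measurable sets, so measurability is shown
directly and not deduced from openness. -/
lemma measurableSet_testSet (μ₀ : Measure X) (β : ℝ) (f : C(X, ℝ)) (v : C(X × X, ℝ)) (b c : ℝ) :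
    MeasurableSet (testSet μ₀ β f v b c) := by
  have h1 := measurable_integral_continuousMap f
  have h2 : Measurable fun ν : ProbabilityMeasure X =>
      ∫ p, v p ∂((ν.prod ν : ProbabilityMeasure (X × X)) : Measure (X × X)) :=
    (measurable_integral_continuousMap v).comp
      ((ProbabilityMeasure.measurable_fun_prod.comp
        (measurable_id.prodMk measurable_id)).subtype_mk)
  exact (measurableSet_lt measurable_const ((h1.add_const 1).sub_const _)).inter
    (measurableSet_lt measurable_const (h2.const_mul β))

/-- On the test set the energy of `v` contributes `exp (-N c)`. Hölder splits the rest into the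
event to the power `1 - θ`, controlled by Chebyshev, and the error `G` to the power `θ`, controlled
by decoupling. -/
lemma setLIntegral_testSet_le (μ₀ : Measure X) [IsProbabilityMeasure μ₀] {w : X × X → ℝ}
    (hw : Measurable w) (β : ℝ) (f : C(X, ℝ)) (v : C(X × X, ℝ)) (b c : ℝ) {θ : ℝ} (hθ : 0 < θ)
    (hθ1 : θ ≤ 1)
    (hv : ∫⁻ p, ENNReal.ofReal (Real.exp (2 * (|β| / θ) * |w p - v p|)) ∂(μ₀.prod μ₀) ≤ 2)
    (N : ℕ+) :
    ∫⁻ x in empiricalMeasure N ⁻¹' testSet μ₀ β f v b c,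
        ENNReal.ofReal (Real.exp (-(β * ((N : ℝ)⁻¹ * pairSum w N x))))
        ∂(Measure.pi fun _ : Fin N => μ₀) ≤
      ENNReal.ofReal (Real.exp (|β| * ‖v‖) * Real.exp (-(N * (c + (1 - θ) * b - θ)))) := by
  set P := Measure.pi fun _ : Fin N => μ₀ with hP
  have hN : (0 : ℝ) < ((N : ℕ) : ℝ) := by exact_mod_cast N.pos
  have hvm : Measurable v := Continuous.measurable v.continuous
  set g : X × X → ℝ := fun p => |β| / θ * |w p - v p| with hg
  have hgm : Measurable g := (hw.sub hvm).abs.const_mul _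
  have hg0 : ∀ p, 0 ≤ g p := fun p => by positivity
  set G : (Fin N → X) → ℝ≥0∞ := fun x =>
    ENNReal.ofReal (Real.exp ((N : ℝ)⁻¹ * pairSum g N x)) with hG
  have hGm : Measurable G := ((measurable_pairSum hgm N).const_mul _).exp.ennreal_ofReal
  set B : Set (Fin N → X) := empiricalMeasure N ⁻¹' testSet μ₀ β f v b c with hB
  have hBm : MeasurableSet B := measurable_empiricalMeasure N (measurableSet_testSet μ₀ β f v b c)
  set C := Real.exp (|β| * ‖v‖) * Real.exp (-(N * c)) with hC
  have hC0 : 0 ≤ C := by positivity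
  have hpt : ∀ x, B.indicator (fun x =>
      ENNReal.ofReal (Real.exp (-(β * ((N : ℝ)⁻¹ * pairSum w N x))))) x ≤
      ENNReal.ofReal C * (B.indicator 1 x ^ (1 - θ) * G x ^ θ) := fun x => by
    by_cases hx : x ∈ B
    · rw [Set.indicator_of_mem hx, Set.indicator_of_mem hx, Pi.one_apply, ENNReal.one_rpow, one_mul,
        hG, ENNReal.ofReal_rpow_of_pos (Real.exp_pos _), ← ENNReal.ofReal_mul hC0, ← Real.exp_mul]
      refine ENNReal.ofReal_le_ofReal ?_
      rw [hC, ← Real.exp_add, ← Real.exp_add, Real.exp_le_exp]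
      have h1 : pairSum w N x = pairSum v N x + pairSum (fun p => w p - v p) N x := by
        simp only [pairSum, ← Finset.sum_add_distrib]
        exact Finset.sum_congr rfl fun p _ => by ring
      have h2 : |β * pairSum (fun p => w p - v p) N x| ≤ pairSum g N x * θ := by
        rw [abs_mul, pairSum, pairSum, Finset.sum_mul]
        calc _ ≤ |β| * ∑ p ∈ (Finset.univ : Finset (Fin N)).offDiag,
              |w (x p.1, x p.2) - v (x p.1, x p.2)| := by
              gcongr; exact Finset.abs_sum_le_sum_abs _ _
          _ = _ := by
              rw [Finset.mul_sum]
              refine Finset.sum_congr rfl fun p _ => ?_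
              rw [hg]; field_simp
      have h3 := inv_mul_pairSum_eq N x v
      have h4 := abs_inv_mul_sum_le N x v
      have h5 : c < β * ∫ p, v p ∂((empiricalMeasure N x : Measure X).prod
        (empiricalMeasure N x : Measure X)) := hx.2
      set I := ∫ p, v p ∂((empiricalMeasure N x : Measure X).prod
        (empiricalMeasure N x : Measure X)) with hI
      set J := (N : ℝ)⁻¹ * ∑ i, v (x i, x i) with hJ
      have h6 : |β * J| ≤ |β| * ‖v‖ := by rw [abs_mul]; gcongr
      have h7 : (N : ℝ) * c ≤ N * (β * I) := by gcongr
      have h8 : (N : ℝ)⁻¹ * (-(β * pairSum (fun p => w p - v p) N x)) ≤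
          (N : ℝ)⁻¹ * (pairSum g N x * θ) := by
        gcongr; exact (neg_le_abs _).trans h2
      calc -(β * ((N : ℝ)⁻¹ * pairSum w N x))
          = -(β * ((N : ℝ)⁻¹ * pairSum v N x)) +
            (N : ℝ)⁻¹ * (-(β * pairSum (fun p => w p - v p) N x)) := by rw [h1]; ring
        _ ≤ _ := by rw [h3]; linarith [le_abs_self (β * J)]
    · rw [Set.indicator_of_notMem hx]; exact zero_le
  rw [← lintegral_indicator hBm]
  have hPB : P B ≤ ENNReal.ofReal (Real.exp (-(N * b))) :=
    (measure_mono fun x hx => hx.1).trans (measure_empiricalMeasure_le μ₀ f b N)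
  -- Decoupling gives at most `2 ^ (N / 2)`, bounded crudely by `exp N`; the power `θ` later makes
  -- this negligible.
  have hGi : ∫⁻ x, G x ∂P ≤ ENNReal.ofReal (Real.exp N) := by
    refine (lintegral_exp_pairSum_le μ₀ hgm hg0 N).trans ?_
    have h1 : ∫⁻ p, ENNReal.ofReal (Real.exp (2 * g p)) ∂(μ₀.prod μ₀) ≤
        ENNReal.ofReal (Real.exp 1) := by
      refine le_trans (le_trans (le_of_eq ?_) hv) ?_
      · simp only [hg, mul_assoc]
      · rw [← ENNReal.ofReal_ofNat]
        exact ENNReal.ofReal_le_ofReal (by linarith [Real.add_one_le_exp 1])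
    calc _ ≤ ENNReal.ofReal (Real.exp 1) ^ ((N : ℕ) / 2) := by gcongr
      _ ≤ ENNReal.ofReal (Real.exp 1) ^ (N : ℕ) :=
          pow_le_pow_right₀ (ENNReal.one_le_ofReal.2 (Real.one_le_exp zero_le_one))
            (Nat.div_le_self _ _)
      _ = _ := by
          rw [← ENNReal.ofReal_pow (Real.exp_pos _).le, ← Real.exp_nat_mul, mul_one]
  have hind : Measurable (B.indicator (1 : (Fin N → X) → ℝ≥0∞)) := measurable_one.indicator hBm
  calc _ ≤ ∫⁻ x, ENNReal.ofReal C * (B.indicator 1 x ^ (1 - θ) * G x ^ θ) ∂P := lintegral_mono hpt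
    _ = ENNReal.ofReal C * ∫⁻ x, B.indicator 1 x ^ (1 - θ) * G x ^ θ ∂P :=
        lintegral_const_mul _ ((hind.pow_const _).mul (hGm.pow_const _))
    _ ≤ ENNReal.ofReal C * ((∫⁻ x, B.indicator 1 x ∂P) ^ (1 - θ) * (∫⁻ x, G x ∂P) ^ θ) := by
        gcongr
        exact ENNReal.lintegral_mul_norm_pow_le hind.aemeasurable hGm.aemeasurable (by linarith)
          hθ.le (by ring)
    _ ≤ ENNReal.ofReal C * (ENNReal.ofReal (Real.exp (-(N * b))) ^ (1 - θ) *
          ENNReal.ofReal (Real.exp N) ^ θ) := by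
        rw [lintegral_indicator_one hBm]
        gcongr
    _ = _ := by
        rw [ENNReal.ofReal_rpow_of_pos (Real.exp_pos _), ENNReal.ofReal_rpow_of_pos (Real.exp_pos _),
          ← Real.exp_mul, ← Real.exp_mul, ← ENNReal.ofReal_mul (Real.exp_pos _).le,
          ← ENNReal.ofReal_mul hC0, hC, ← Real.exp_add, ← Real.exp_add, ← Real.exp_add,
          ← Real.exp_add]
        congr 2; ring

end Continuous

/-! ### The local upper bound for real-valued interactions. -/

section RealInteraction

/-- The non-normalized Gibbs measure of a real-valued pair interaction. -/
noncomputable def realGibbsWeight {X : Type*} [MeasurableSpace X] (μ₀ : Measure X) (w : X × X → ℝ)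
    (β : ℝ) (N : ℕ+) : Measure (Fin N → X) :=
  (Measure.pi fun _ : Fin N => μ₀).withDensity
    fun x => ENNReal.ofReal (Real.exp (-(β * ((N : ℝ)⁻¹ * pairSum w N x))))

open Classical in
/-- The free energy functional of a real-valued pair interaction. -/
noncomputable def realFreeEnergy {X : Type*} [MeasurableSpace X] (μ₀ : Measure X) (w : X × X → ℝ)
    (β : ℝ) (μ : ProbabilityMeasure X) : EReal :=
  if relEntropy μ₀ μ = ∞ then ⊤
  else ((β * ∫ p, w p ∂((μ : Measure X).prod (μ : Measure X)) + (relEntropy μ₀ μ).toReal : ℝ) :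
    EReal)

variable {X : Type*} [TopologicalSpace X] [CompactSpace X] [TopologicalSpace.MetrizableSpace X]
  [MeasurableSpace X] [BorelSpace X]

lemma exists_isOpen_map_realGibbsWeight_le (μ₀ : Measure X) [IsProbabilityMeasure μ₀]
    {w : X × X → ℝ} (hw : Measurable w) (β : ℝ) (μ : ProbabilityMeasure X) (v : C(X × X, ℝ))
    {a b c θ : ℝ} (hθ : 0 < θ) (hθ1 : θ ≤ 1)
    (hv : ∫⁻ p, ENNReal.ofReal (Real.exp (2 * (|β| / θ) * |w p - v p|)) ∂(μ₀.prod μ₀) ≤ 2)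
    (hb : (b : EReal) < (relEntropy μ₀ μ : EReal))
    (hc : c < β * ∫ p, v p ∂((μ : Measure X).prod (μ : Measure X)))
    (ha : a < c + (1 - θ) * b - θ) :
    ∃ U : Set (ProbabilityMeasure X), IsOpen U ∧ μ ∈ U ∧ ∀ᶠ N : ℕ+ in atTop,
      (realGibbsWeight μ₀ w β N).map (empiricalMeasure N) U ≤
        ENNReal.ofReal (Real.exp (-(N * a))) := by
  obtain ⟨f, hf⟩ := exists_continuousMap_lt_of_lt_klDiv hb
  refine ⟨testSet μ₀ β f v b c, isOpen_testSet μ₀ β f v b c, ⟨hf, hc⟩, ?_⟩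
  filter_upwards [eventually_const_mul_exp_le (Real.exp (|β| * ‖v‖)) ha] with N hN
  have hm := measurableSet_testSet μ₀ β f v b c
  rw [Measure.map_apply (measurable_empiricalMeasure N) hm, realGibbsWeight,
    withDensity_apply _ (measurable_empiricalMeasure N hm)]
  exact (setLIntegral_testSet_le μ₀ hw β f v b c hθ hθ1 hv N).trans (ENNReal.ofReal_le_ofReal hN)

/-- The entropy inequality with `K = 2` turns the exponential bound into an `L¹(μ ⊗ μ)` bound. One
`v` serves every `μ` of finite entropy. -/
lemma exists_continuousMap_pair_approx (μ₀ : Measure X) [IsProbabilityMeasure μ₀]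
    {w : X × X → ℝ} (hw : Measurable w)
    (hexp : ∀ t : ℝ, Integrable (fun p => Real.exp (t * |w p|)) (μ₀.prod μ₀)) (β : ℝ) {θ : ℝ}
    (hθ : 0 < θ) :
    ∃ v : C(X × X, ℝ),
      ∫⁻ p, ENNReal.ofReal (Real.exp (2 * (|β| / θ) * |w p - v p|)) ∂(μ₀.prod μ₀) ≤ 2 ∧
      ∀ μ : ProbabilityMeasure X, relEntropy μ₀ μ ≠ ∞ →
        Integrable w ((μ : Measure X).prod (μ : Measure X)) ∧
        |β| * ∫ p, |w p - v p| ∂((μ : Measure X).prod (μ : Measure X)) ≤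
          θ * (2 * (relEntropy μ₀ μ).toReal + 1) := by
  -- The numerator dominates the `2 |β|` needed for decoupling; the `+ 1` keeps `t` positive when `β
  -- = 0`.
  set t := (2 * |β| + 1) / θ with ht
  have ht0 : 0 < t := by positivity
  obtain ⟨v, hv⟩ := exists_continuousMap_lintegral_exp_le_two (μ₀.prod μ₀) hw hexp ht0
  have hvm : Measurable v := Continuous.measurable v.continuous
  refine ⟨v, le_trans (lintegral_mono fun p => ENNReal.ofReal_le_ofReal (Real.exp_le_exp.2 ?_)) hv,
    fun μ hμ => ?_⟩
  · refine mul_le_mul_of_nonneg_right ?_ (abs_nonneg _)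
    rw [ht, ← mul_div_assoc]
    gcongr
    linarith
  · obtain ⟨hac, hllr⟩ := InformationTheory.klDiv_ne_top_iff.1 hμ
    have hD : (relEntropy μ₀ μ).toReal = ∫ x, llr (μ : Measure X) μ₀ x ∂(μ : Measure X) :=
      InformationTheory.toReal_klDiv_of_measure_eq hac (by simp)
    obtain ⟨hi, hle⟩ := integral_prod_le_of_lintegral_exp_le hac hllr
      (g := fun p => t * |w p - v p|) ((hw.sub hvm).abs.const_mul t) (fun p => by positivity)
      (K := 2) (by norm_num) (by simpa using hv)
    have hi' : Integrable (fun p => |w p - v p|) ((μ : Measure X).prod (μ : Measure X)) :=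
      (integrable_const_mul_iff (isUnit_iff_ne_zero.2 ht0.ne') _).1 hi
    refine ⟨?_, ?_⟩
    · have h1 : Integrable (fun p => w p - v p) ((μ : Measure X).prod (μ : Measure X)) :=
        (integrable_norm_iff (hw.sub hvm).aestronglyMeasurable).1 hi'
      exact (h1.add (integrable_continuousMap _ v)).congr (ae_of_all _ fun p => by simp)
    · rw [integral_const_mul, ← hD] at hle
      set J := ∫ p, |w p - v p| ∂((μ : Measure X).prod (μ : Measure X)) with hJ
      have hJ0 : 0 ≤ J := integral_nonneg fun p => abs_nonneg _
      have h2 : (2 * |β| + 1) * J ≤ θ * (2 * (relEntropy μ₀ μ).toReal + 1) := by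
        calc (2 * |β| + 1) * J = θ * (t * J) := by rw [ht]; field_simp
          _ ≤ _ := by gcongr; linarith
      nlinarith [abs_nonneg β]

theorem localUpperBound_realGibbsWeight (μ₀ : Measure X) [IsProbabilityMeasure μ₀]
    {w : X × X → ℝ} (hw : Measurable w)
    (hexp : ∀ t : ℝ, Integrable (fun p => Real.exp (t * |w p|)) (μ₀.prod μ₀)) (β : ℝ) :
    LocalUpperBound (fun N => (realGibbsWeight μ₀ w β N).map (empiricalMeasure N))
      (realFreeEnergy μ₀ w β) := by
  intro μ a ha
  by_cases hμ : relEntropy μ₀ μ = ∞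
  · obtain ⟨v, hv, -⟩ := exists_continuousMap_pair_approx μ₀ hw hexp β one_half_pos
    set c := β * ∫ p, v p ∂((μ : Measure X).prod (μ : Measure X)) - 1 with hc
    -- Infinite entropy allows any `b`; with `θ = 1/2` this one gives the rate `a + 1/2`.
    refine exists_isOpen_map_realGibbsWeight_le μ₀ hw β μ v (b := 2 * (a - c + 1)) (c := c)
      one_half_pos (by norm_num) hv ?_ (by rw [hc]; linarith) (by linarith)
    rw [hμ]
    exact EReal.coe_lt_top _
  · rw [realFreeEnergy, if_neg hμ, EReal.coe_lt_coe_iff] at ha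
    set E := ∫ p, w p ∂((μ : Measure X).prod (μ : Measure X)) with hE
    set D := (relEntropy μ₀ μ).toReal with hD
    have hD0 : 0 ≤ D := ENNReal.toReal_nonneg
    obtain ⟨b, hb1, hb2⟩ := exists_between (show a - β * E < D by linarith)
    set δ := β * E + b - a with hδ
    have hδ0 : 0 < δ := by rw [hδ]; linarith
    -- `θ M` bounds the total loss: `θ (2D + 1)` from the energy, `θ` for strictness of `c`, and `θ
    -- b + θ` from Hölder.
    set M := 2 * D + 3 + |b| with hM
    have hM0 : 0 < M := by positivity
    set θ := min 1 (δ / (2 * M)) with hθ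
    have hθ0 : 0 < θ := lt_min one_pos (by positivity)
    have hθM : θ * M ≤ δ / 2 := by
      calc θ * M ≤ δ / (2 * M) * M := by gcongr; exact min_le_right _ _
        _ = δ / 2 := by field_simp
    obtain ⟨v, hv, hv'⟩ := exists_continuousMap_pair_approx μ₀ hw hexp β hθ0
    obtain ⟨hwi, hle⟩ := hv' μ hμ
    have h1 : β * E - β * ∫ p, v p ∂((μ : Measure X).prod (μ : Measure X)) ≤
        θ * (2 * D + 1) := by
      refine le_trans ?_ hle
      rw [hE, ← mul_sub, ← integral_sub hwi (integrable_continuousMap _ v)]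
      refine (le_abs_self _).trans ?_
      rw [abs_mul]
      gcongr
      exact abs_integral_le_integral_abs
    refine exists_isOpen_map_realGibbsWeight_le μ₀ hw β μ v (b := b)
      (c := β * E - θ * (2 * D + 1) - θ) hθ0 (min_le_left _ _) hv ?_ (by linarith) ?_
    · rw [← ENNReal.ofReal_toReal hμ, EReal.coe_ennreal_ofReal, max_eq_left hD0]
      exact EReal.coe_lt_coe_iff.2 hb2
    · have h2 : θ * b ≤ θ * |b| := by gcongr; exact le_abs_self b
      rw [hM] at hθM
      nlinarith

end RealInteraction

/-! ### The local lower bound. -/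

lemma integral_comp_measurePreserving {Y Ω : Type*} [MeasurableSpace Y] [MeasurableSpace Ω]
    {P : Measure Ω} {Q : Measure Y} {T : Ω → Y} (hT : MeasurePreserving T P Q) {g : Y → ℝ}
    (hg : Integrable g Q) : ∫ ω, g (T ω) ∂P = ∫ y, g y ∂Q := by
  rw [← hT.map_eq, integral_map hT.aemeasurable (by rw [hT.map_eq]; exact hg.aestronglyMeasurable)]

lemma card_offDiag_fin (N : ℕ) :
    (((Finset.univ : Finset (Fin N)).offDiag.card : ℕ) : ℝ) = N * (N - 1) := by
  rw [Finset.offDiag_card, Finset.card_univ, Fintype.card_fin, Nat.cast_sub (Nat.le_mul_self N)]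
  push_cast; ring

/-- Uniform integrability in quantitative form: the bound depends on `B` only through its
probability, and is the same for every `T` with law `Q`. -/
lemma setIntegral_abs_comp_le {Y Ω : Type*} [TopologicalSpace Y] [MeasurableSpace Y]
    [OpensMeasurableSpace Y] [MeasurableSpace Ω] {Q : Measure Y} [IsFiniteMeasure Q] {g : Y → ℝ}
    (hg : Integrable g Q) (h : BoundedContinuousFunction Y ℝ) (P : Measure Ω) [IsFiniteMeasure P]
    {T : Ω → Y} (hT : MeasurePreserving T P Q) (B : Set Ω) :
    ∫ ω in B, |g (T ω)| ∂P ≤ ‖h‖ * P.real B + ∫ y, |g y - h y| ∂Q := by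
  have hhi : Integrable h Q := h.integrable Q
  have hd : Integrable (fun y => |g y - h y|) Q := (hg.sub hhi).abs
  have h1 : Integrable (fun ω => |g (T ω) - h (T ω)|) P := hT.integrable_comp_of_integrable hd
  have h2 : ∫ ω in B, |g (T ω) - h (T ω)| ∂P ≤ ∫ y, |g y - h y| ∂Q := by
    exact (setIntegral_le_integral h1 (ae_of_all _ fun ω => abs_nonneg _)).trans
      (integral_comp_measurePreserving hT hd).le
  have h3 : Integrable (fun ω => |g (T ω)|) P := hT.integrable_comp_of_integrable hg.abs
  calc ∫ ω in B, |g (T ω)| ∂P ≤ ∫ ω in B, (‖h‖ + |g (T ω) - h (T ω)|) ∂P := by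
        refine integral_mono h3.restrict ((integrable_const _).add h1.restrict) fun ω => ?_
        have h4 := h.norm_coe_le_norm (T ω)
        rw [Real.norm_eq_abs] at h4
        have h5 := abs_add_le (h (T ω)) (g (T ω) - h (T ω))
        rw [add_sub_cancel] at h5
        exact h5.trans (by gcongr)
    _ = ‖h‖ * P.real B + ∫ ω in B, |g (T ω) - h (T ω)| ∂P := by
        rw [integral_add (integrable_const _) h1.restrict, setIntegral_const, smul_eq_mul, mul_comm]
    _ ≤ _ := by gcongr

lemma ofReal_integral_le_lintegral_ofReal {Ω : Type*} [MeasurableSpace Ω] {P : Measure Ω}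
    {f : Ω → ℝ} (hf : Integrable f P) :
    ENNReal.ofReal (∫ ω, f ω ∂P) ≤ ∫⁻ ω, ENNReal.ofReal (f ω) ∂P := by
  rw [integral_eq_lintegral_pos_part_sub_lintegral_neg_part hf]
  exact (ENNReal.ofReal_le_ofReal (sub_le_self _ ENNReal.toReal_nonneg)).trans
    ENNReal.ofReal_toReal_le

/-- A lower bound for exponential integrals obtained from the tangent line of the exponential. -/
lemma ofReal_exp_mul_le_setLIntegral {Ω : Type*} [MeasurableSpace Ω] {P : Measure Ω}
    [IsFiniteMeasure P] {f : Ω → ℝ} (hf : Integrable f P) (A : Set Ω) (s : ℝ) :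
    ENNReal.ofReal (Real.exp (-s) * (P.real A * (1 + s) - ∫ ω in A, f ω ∂P)) ≤
      ∫⁻ ω in A, ENNReal.ofReal (Real.exp (-f ω)) ∂P := by
  have h1 : Integrable (fun ω => Real.exp (-s) * ((1 + s) - f ω)) (P.restrict A) :=
    ((integrable_const _).sub hf.restrict).const_mul _
  have h2 : ∫ ω in A, Real.exp (-s) * ((1 + s) - f ω) ∂P =
      Real.exp (-s) * (P.real A * (1 + s) - ∫ ω in A, f ω ∂P) := by
    rw [integral_const_mul, integral_sub (integrable_const _) hf.restrict, setIntegral_const,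
      smul_eq_mul]
  rw [← h2]
  refine (ofReal_integral_le_lintegral_ofReal h1).trans
    (lintegral_mono fun ω => ENNReal.ofReal_le_ofReal ?_)
  have h3 := Real.add_one_le_exp (s - f ω)
  calc Real.exp (-s) * ((1 + s) - f ω) ≤ Real.exp (-s) * Real.exp (s - f ω) := by
        gcongr; linarith
    _ = _ := by rw [← Real.exp_add]; congr 1; ring

section LowerBound

variable {X : Type*} [TopologicalSpace X] [CompactSpace X] [TopologicalSpace.MetrizableSpace X]
  [MeasurableSpace X] [BorelSpace X]

lemma continuous_empiricalMeasure {X : Type*} [TopologicalSpace X] [CompactSpace X]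
    [MeasurableSpace X] [BorelSpace X] (N : ℕ+) :
    Continuous (empiricalMeasure N : (Fin N → X) → ProbabilityMeasure X) := by
  refine ProbabilityMeasure.continuous_iff_forall_continuousMap_continuous_integral.2 fun f => ?_
  simp_rw [integral_empiricalMeasure N _ (Continuous.stronglyMeasurable f.continuous)]
  fun_prop

/-- The weak law of large numbers for empirical measures. -/
lemma tendsto_measure_empiricalMeasure_compl (μ : ProbabilityMeasure X)
    {U : Set (ProbabilityMeasure X)} (hU : IsOpen U) (hμU : μ ∈ U) :
    Tendsto (fun N : ℕ+ => (Measure.pi fun _ : Fin N => (μ : Measure X))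
      (empiricalMeasure N ⁻¹' Uᶜ)) atTop (𝓝 0) := by
  refine hU.isClosed_compl.isCompact.induction_on (p := fun S => Tendsto (fun N : ℕ+ =>
    (Measure.pi fun _ : Fin N => (μ : Measure X)) (empiricalMeasure N ⁻¹' S)) atTop (𝓝 0))
    (by simp) (fun S T hST hT => ?_) (fun S T hS hT => ?_) (fun ν hν => ?_)
  · exact tendsto_of_tendsto_of_tendsto_of_le_of_le tendsto_const_nhds hT (fun _ => zero_le)
      fun N => measure_mono (Set.preimage_mono hST)
  · refine tendsto_of_tendsto_of_tendsto_of_le_of_le tendsto_const_nhds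
      (by simpa using hS.add hT) (fun _ => zero_le) fun N => ?_
    exact measure_union_le _ _
  · have hne : (ν : Measure X) ≠ μ := fun h => hν (by
      rwa [show ν = μ from ProbabilityMeasure.toMeasure_injective h])
    have h0 : ((0 : ℝ) : EReal) <
        ((InformationTheory.klDiv (ν : Measure X) μ : ℝ≥0∞) : EReal) := by
      rw [EReal.coe_zero, EReal.coe_ennreal_pos]
      exact pos_iff_ne_zero.2 fun h => hne (InformationTheory.klDiv_eq_zero_iff.1 h)
    obtain ⟨f, hf⟩ := exists_continuousMap_lt_of_lt_klDiv h0
    obtain ⟨b, hb0, hb⟩ := exists_between hf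
    refine ⟨{ν' | b < ∫ y, f y ∂(ν' : Measure X) + 1 - ∫ y, Real.exp (f y) ∂(μ : Measure X)},
      mem_nhdsWithin_of_mem_nhds (IsOpen.mem_nhds ?_ hb), ?_⟩
    · have h1 : Continuous fun ν : ProbabilityMeasure X => ∫ y, f y ∂(ν : Measure X) :=
        ProbabilityMeasure.continuous_integral_continuousMap f
      exact isOpen_lt continuous_const ((h1.add_const 1).sub continuous_const)
    · have h2 : Tendsto (fun N : ℕ+ => ENNReal.ofReal (Real.exp (-(N * b)))) atTop (𝓝 0) := by
        rw [← ENNReal.ofReal_zero]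
        exact (ENNReal.continuous_ofReal.tendsto _).comp
          (Real.tendsto_exp_neg_atTop_nhds_zero.comp (tendsto_pnat_cast_atTop.atTop_mul_const hb0))
      exact tendsto_of_tendsto_of_tendsto_of_le_of_le tendsto_const_nhds h2 (fun _ => zero_le)
        fun N => measure_empiricalMeasure_le (μ : Measure X) f b N

/-- The change of measure bound behind the large deviation lower bound. -/
lemma setLIntegral_exp_le_map_realGibbsWeight (μ₀ : Measure X) [IsProbabilityMeasure μ₀]
    {w : X × X → ℝ} (hw : Measurable w) (β : ℝ) {μ : Measure X} [IsProbabilityMeasure μ]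
    (hac : μ ≪ μ₀) {U : Set (ProbabilityMeasure X)} (hU : IsOpen U) (N : ℕ+) :
    ∫⁻ x in empiricalMeasure N ⁻¹' U, ENNReal.ofReal (Real.exp
        (-(β * ((N : ℝ)⁻¹ * pairSum w N x) + ∑ i, llr μ μ₀ (x i))))
        ∂(Measure.pi fun _ : Fin N => μ) ≤
      (realGibbsWeight μ₀ w β N).map (empiricalMeasure N) U := by
  have hAm : MeasurableSet (empiricalMeasure N ⁻¹' U) :=
    (hU.preimage (continuous_empiricalMeasure N)).measurableSet
  -- This inequality needs no measurability of `U` in `P(X)`; only its preimage must be measurable.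
  refine le_trans ?_ (Measure.le_map_apply (measurable_empiricalMeasure N).aemeasurable U)
  rw [realGibbsWeight, withDensity_apply _ hAm, ← lintegral_indicator hAm, ← lintegral_indicator hAm]
  have hF : Measurable fun x : Fin N → X =>
      ENNReal.ofReal (Real.exp (-(β * ((N : ℝ)⁻¹ * pairSum w N x)))) :=
    (((measurable_pairSum hw N).const_mul _).const_mul β).neg.exp.ennreal_ofReal
  refine le_trans (lintegral_mono fun x => ?_)
    (lintegral_mul_exp_neg_sum_llr_le hac (hF.indicator hAm))
  by_cases hx : x ∈ empiricalMeasure N ⁻¹' U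
  · rw [Set.indicator_of_mem hx, Set.indicator_of_mem hx, ← ENNReal.ofReal_mul (Real.exp_pos _).le,
      ← Real.exp_add, neg_add]
  · rw [Set.indicator_of_notMem hx]; exact zero_le

theorem localLowerBound_realGibbsWeight (μ₀ : Measure X) [IsProbabilityMeasure μ₀]
    {w : X × X → ℝ} (hw : Measurable w)
    (hexp : ∀ t : ℝ, Integrable (fun p => Real.exp (t * |w p|)) (μ₀.prod μ₀)) (β : ℝ) :
    LocalLowerBound (fun N => (realGibbsWeight μ₀ w β N).map (empiricalMeasure N))
      (realFreeEnergy μ₀ w β) := by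
  intro μ a ha U hU hμU
  have hμ : relEntropy μ₀ μ ≠ ∞ := fun h => by
    rw [realFreeEnergy, if_pos h] at ha; exact not_top_lt ha
  rw [realFreeEnergy, if_neg hμ, EReal.coe_lt_coe_iff] at ha
  obtain ⟨hac, hllr⟩ := InformationTheory.klDiv_ne_top_iff.1 hμ
  have hD : (relEntropy μ₀ μ).toReal = ∫ x, llr (μ : Measure X) μ₀ x ∂(μ : Measure X) :=
    InformationTheory.toReal_klDiv_of_measure_eq hac (by simp)
  -- Used only for the integrability of `w` under `μ ⊗ μ`.
  obtain ⟨v, -, hv⟩ := exists_continuousMap_pair_approx μ₀ hw hexp β one_pos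
  have hwi := (hv μ hμ).1
  set E := ∫ p, w p ∂((μ : Measure X).prod (μ : Measure X)) with hE
  set D := (relEntropy μ₀ μ).toReal with hDdef
  obtain ⟨a₁, h1, h2⟩ := exists_between ha
  set δ := a₁ - (β * E + D) with hδ
  have hδ0 : 0 < δ := by rw [hδ]; linarith
  -- Makes the `L¹` errors of both bounded approximations cost `δ / 2` in total.
  set ε := δ / (2 * (|β| + 1)) with hε
  have hε0 : 0 < ε := by positivity
  obtain ⟨h, hh, -⟩ := hwi.exists_boundedContinuous_integral_sub_le hε0
  obtain ⟨k, hk, -⟩ := hllr.exists_boundedContinuous_integral_sub_le hε0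
  simp only [Real.norm_eq_abs] at hh hk
  set M := max ‖h‖ ‖k‖ with hM
  set P : (N : ℕ+) → Measure (Fin N → X) := fun N => Measure.pi fun _ : Fin N => (μ : Measure X)
    with hP
  set A : (N : ℕ+) → Set (Fin N → X) := fun N => empiricalMeasure N ⁻¹' U with hA
  have hAm : ∀ N, MeasurableSet (A N) := fun N =>
    (hU.preimage (continuous_empiricalMeasure N)).measurableSet
  set q : ℕ+ → ℝ := fun N => (P N).real (A N)ᶜ with hq
  have hq0 : Tendsto q atTop (𝓝 0) := by
    have := (ENNReal.tendsto_toReal ENNReal.zero_ne_top).comp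
      (tendsto_measure_empiricalMeasure_compl μ hU hμU)
    exact this
  set f : (N : ℕ+) → (Fin N → X) → ℝ := fun N x =>
    β * ((N : ℝ)⁻¹ * pairSum w N x) + ∑ i, llr (μ : Measure X) μ₀ (x i) with hf
  have hpairT : ∀ (N : ℕ+), ∀ p ∈ (Finset.univ : Finset (Fin N)).offDiag,
      MeasurePreserving (fun x : Fin N → X => (x p.1, x p.2)) (P N)
        ((μ : Measure X).prod (μ : Measure X)) := fun N p hp =>
    measurePreserving_pi_pair (μ : Measure X) (Finset.mem_offDiag.1 hp).2.2
  have hevalT : ∀ (N : ℕ+) (i : Fin N),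
      MeasurePreserving (fun x : Fin N → X => x i) (P N) (μ : Measure X) := fun N i =>
    measurePreserving_eval (fun _ : Fin N => (μ : Measure X)) i
  have hpi : ∀ (N : ℕ+), ∀ p ∈ (Finset.univ : Finset (Fin N)).offDiag,
      Integrable (fun x => w (x p.1, x p.2)) (P N) := fun N p hp =>
    (hpairT N p hp).integrable_comp_of_integrable hwi
  have hei : ∀ (N : ℕ+) (i : Fin N), Integrable (fun x => llr (μ : Measure X) μ₀ (x i)) (P N) :=
    fun N i => (hevalT N i).integrable_comp_of_integrable hllr
  have hpsi : ∀ N : ℕ+, Integrable (pairSum w N) (P N) := fun N => integrable_finsetSum _ (hpi N)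
  have hlsi : ∀ N : ℕ+, Integrable (fun x => ∑ i, llr (μ : Measure X) μ₀ (x i)) (P N) := fun N =>
    integrable_finsetSum _ fun i _ => hei N i
  have hfi : ∀ N, Integrable (f N) (P N) := fun N =>
    (((hpsi N).const_mul _).const_mul β).add (hlsi N)
  have hfint : ∀ N : ℕ+, ∫ x, f N x ∂(P N) = β * ((N - 1) * E) + N * D := fun N => by
    have hN : ((N : ℕ) : ℝ) ≠ 0 := by exact_mod_cast N.pos.ne'
    have e1 : ∫ x, pairSum w N x ∂(P N) = N * (N - 1) * E := by
      simp only [pairSum]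
      rw [integral_finsetSum _ (hpi N), Finset.sum_congr rfl fun p hp =>
        integral_comp_measurePreserving (hpairT N p hp) hwi, Finset.sum_const, nsmul_eq_mul,
        card_offDiag_fin]
    have e2 : ∫ x, ∑ i, llr (μ : Measure X) μ₀ (x i) ∂(P N) = N * D := by
      rw [integral_finsetSum _ fun i _ => hei N i, Finset.sum_congr rfl fun i _ =>
        integral_comp_measurePreserving (hevalT N i) hllr, Finset.sum_const, nsmul_eq_mul, hD,
        Finset.card_univ, Fintype.card_fin]
    rw [hf, integral_add (((hpsi N).const_mul _).const_mul β) (hlsi N), integral_const_mul,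
      integral_const_mul, e1, e2]
    field_simp
  have hN1 : ∀ N : ℕ+, (1 : ℝ) ≤ ((N : ℕ) : ℝ) := fun N => by exact_mod_cast Nat.succ_le_of_lt N.pos
  -- The part of `f N` off the neighbourhood is `o(N)` up to `N (|β| + 1) ε`, since `q N → 0`; hence
  -- its integral over `A N` is barely above its full mean.
  have hfc : ∀ N : ℕ+, -(N * ((|β| + 1) * (M * q N + ε))) ≤ ∫ x in (A N)ᶜ, f N x ∂(P N) :=
    fun N => by
    have hN0 : (0 : ℝ) < ((N : ℕ) : ℝ) := lt_of_lt_of_le one_pos (hN1 N)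
    have hqN : 0 ≤ q N := measureReal_nonneg
    have e1 : ∀ x, |f N x| ≤ |β| * ((N : ℝ)⁻¹ *
        ∑ p ∈ (Finset.univ : Finset (Fin N)).offDiag, |w (x p.1, x p.2)|) +
        ∑ i, |llr (μ : Measure X) μ₀ (x i)| := fun x => by
      refine (abs_add_le _ _).trans (add_le_add ?_ (Finset.abs_sum_le_sum_abs _ _))
      rw [abs_mul, abs_mul, abs_of_pos (inv_pos.2 hN0)]
      gcongr
      exact Finset.abs_sum_le_sum_abs _ _
    have i1 : Integrable (fun x : Fin N → X =>
        ∑ p ∈ (Finset.univ : Finset (Fin N)).offDiag, |w (x p.1, x p.2)|) ((P N).restrict (A N)ᶜ) :=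
      integrable_finsetSum _ fun p hp => (hpi N p hp).abs.restrict
    have i2 : Integrable (fun x : Fin N → X => ∑ i, |llr (μ : Measure X) μ₀ (x i)|)
        ((P N).restrict (A N)ᶜ) :=
      integrable_finsetSum _ fun i _ => (hei N i).abs.restrict
    have e2 : ∫ x in (A N)ᶜ, |f N x| ∂(P N) ≤ N * ((|β| + 1) * (M * q N + ε)) := by
      refine (integral_mono (hfi N).abs.restrict (((i1.const_mul _).const_mul _).add i2) e1).trans ?_
      rw [integral_add' ((i1.const_mul _).const_mul _) i2, integral_const_mul, integral_const_mul,
        integral_finsetSum _ fun p hp => (hpi N p hp).abs.restrict,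
        integral_finsetSum _ fun i _ => (hei N i).abs.restrict]
      have s1 : ∑ p ∈ (Finset.univ : Finset (Fin N)).offDiag,
          ∫ x in (A N)ᶜ, |w (x p.1, x p.2)| ∂(P N) ≤ N * (N - 1) * (M * q N + ε) := by
        rw [← card_offDiag_fin, ← nsmul_eq_mul]
        refine Finset.sum_le_card_nsmul _ _ _ fun p hp =>
          (setIntegral_abs_comp_le hwi h (P N) (hpairT N p hp) (A N)ᶜ).trans ?_
        gcongr
        exact le_max_left _ _
      have s2 : ∑ i : Fin N, ∫ x in (A N)ᶜ, |llr (μ : Measure X) μ₀ (x i)| ∂(P N) ≤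
          N * (M * q N + ε) := by
        have s3 := Finset.sum_le_card_nsmul (Finset.univ : Finset (Fin N))
          (fun i => ∫ x in (A N)ᶜ, |llr (μ : Measure X) μ₀ (x i)| ∂(P N)) (M * q N + ε) fun i _ =>
          (setIntegral_abs_comp_le hllr k (P N) (hevalT N i) (A N)ᶜ).trans (by
            gcongr
            exact le_max_right _ _)
        rwa [Finset.card_univ, Fintype.card_fin, nsmul_eq_mul] at s3
      have hM0 : 0 ≤ M := (norm_nonneg h).trans (le_max_left _ _)
      have hm : 0 ≤ M * q N + ε := by positivity
      have s4 : (N : ℝ)⁻¹ * (N * (N - 1) * (M * q N + ε)) ≤ N * (M * q N + ε) := by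
        rw [mul_assoc, inv_mul_cancel_left₀ hN0.ne']
        gcongr
        linarith
      calc _ ≤ |β| * ((N : ℝ)⁻¹ * (N * (N - 1) * (M * q N + ε))) + N * (M * q N + ε) := by gcongr
        _ ≤ |β| * (N * (M * q N + ε)) + N * (M * q N + ε) := by gcongr
        _ = _ := by ring
    have e3 : |∫ x in (A N)ᶜ, f N x ∂(P N)| ≤ ∫ x in (A N)ᶜ, |f N x| ∂(P N) :=
      abs_integral_le_integral_abs
    linarith [neg_abs_le (∫ x in (A N)ᶜ, f N x ∂(P N))]
  have hfA : ∀ N : ℕ+, ∫ x in A N, f N x ∂(P N) ≤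
      N * (β * E + D + (|β| + 1) * (M * q N + ε)) + |β * E| := fun N => by
    have e1 := integral_add_compl (hAm N) (hfi N)
    rw [hfint N] at e1
    have e2 := neg_abs_le (β * E)
    nlinarith [hfc N]
  have hqA : ∀ N, (P N).real (A N) = 1 - q N := fun N => by
    have e1 := probReal_compl_eq_one_sub (μ := P N) (hAm N)
    rw [hq]; linarith
  have hlim1 : Tendsto (fun N : ℕ+ => (1 - q N) * a₁ -
      (β * E + D + (|β| + 1) * (M * q N + ε)) - |β * E| / ((N : ℕ) : ℝ)) atTop
      (𝓝 ((1 - 0) * a₁ - (β * E + D + (|β| + 1) * (M * 0 + ε)) - 0)) :=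
    (((hq0.const_sub 1).mul_const a₁).sub
      ((((hq0.const_mul M).add_const ε).const_mul _).const_add _)).sub
      (tendsto_const_nhds.div_atTop tendsto_pnat_cast_atTop)
  have hpos : 0 < (1 - 0) * a₁ - (β * E + D + (|β| + 1) * (M * 0 + ε)) - 0 := by
    have e1 : (|β| + 1) * ε = δ / 2 := by rw [hε]; field_simp
    rw [mul_zero, zero_add, e1]
    linarith
  filter_upwards [hlim1.eventually (lt_mem_nhds hpos), hq0.eventually (gt_mem_nhds one_half_pos),
    eventually_const_mul_exp_le 2 h2] with N e1 e2 e3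
  -- The tangent is taken at `N a₁`, strictly above the mean of `f N` for large `N`; the bracket is
  -- then at least `1/2`.
  refine le_trans ?_ ((ofReal_exp_mul_le_setLIntegral (hfi N) (A N) (N * a₁)).trans
    (setLIntegral_exp_le_map_realGibbsWeight μ₀ hw β hac hU N))
  refine ENNReal.ofReal_le_ofReal ?_
  have hN0 : (0 : ℝ) < ((N : ℕ) : ℝ) := lt_of_lt_of_le one_pos (hN1 N)
  have e4 : 1 / 2 ≤ (P N).real (A N) * (1 + N * a₁) - ∫ x in A N, f N x ∂(P N) := by
    have e5 := mul_pos hN0 e1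
    rw [mul_sub, mul_div_cancel₀ _ hN0.ne'] at e5
    rw [hqA]
    nlinarith [hfA N]
  calc Real.exp (-(N * a)) ≤ Real.exp (-(N * a₁)) * (1 / 2) := by linarith
    _ ≤ _ := by gcongr

end LowerBound

/-! ### Reduction to a real-valued interaction. -/

section Reduction

variable {X : Type*} [MeasurableSpace X]

/-- A pair interaction with finite exponential moments agrees almost everywhere with a real-valued
measurable one. -/
lemma exists_real_interaction {μ₀ : Measure X} [IsProbabilityMeasure μ₀] {W : X → X → EReal}
    (hW_meas : AEMeasurable (fun p : X × X => W p.1 p.2) (μ₀.prod μ₀))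
    (hW_exp : ∀ t : ℝ,
      ∫⁻ p, EReal.exp (-((t : EReal) * W p.1 p.2)) ∂(μ₀.prod μ₀) < ∞) :
    ∃ w : X × X → ℝ, Measurable w ∧ (∀ᵐ p ∂(μ₀.prod μ₀), W p.1 p.2 = (w p : EReal)) ∧
      ∀ t : ℝ, Integrable (fun p => Real.exp (t * |w p|)) (μ₀.prod μ₀) := by
  -- The moment `t = 1` excludes the value `⊥`, and `t = -1` excludes `⊤`.
  have h1 : ∀ᵐ p ∂(μ₀.prod μ₀), W p.1 p.2 ≠ ⊥ := by
    have h := hW_exp 1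
    simp only [EReal.coe_one, one_mul] at h
    filter_upwards [ae_lt_top' (EReal.measurable_exp.comp_aemeasurable
      (continuous_neg.measurable.comp_aemeasurable hW_meas)) h.ne] with p hp hbot
    simp [hbot] at hp
  have h2 : ∀ᵐ p ∂(μ₀.prod μ₀), W p.1 p.2 ≠ ⊤ := by
    have h := hW_exp (-1)
    simp only [EReal.coe_neg, EReal.coe_one, neg_mul, one_mul, neg_neg] at h
    filter_upwards [ae_lt_top' (EReal.measurable_exp.comp_aemeasurable hW_meas) h.ne] with p hp htop
    simp [htop] at hp
  set w : X × X → ℝ := fun p => (hW_meas.mk _ p).toReal with hw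
  have hwm : Measurable w := hW_meas.measurable_mk.ereal_toReal
  have hae : ∀ᵐ p ∂(μ₀.prod μ₀), W p.1 p.2 = (w p : EReal) := by
    filter_upwards [h1, h2, hW_meas.ae_eq_mk] with p h3 h4 h5
    rw [hw]
    beta_reduce
    rw [← h5, EReal.coe_toReal h4 h3]
  have hexp : ∀ t : ℝ, Integrable (fun p => Real.exp (-(t * w p))) (μ₀.prod μ₀) := fun t => by
    refine ⟨(hwm.const_mul t).neg.exp.aestronglyMeasurable, ?_⟩
    rw [hasFiniteIntegral_iff_ofReal (ae_of_all _ fun p => (Real.exp_pos _).le)]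
    refine (lintegral_congr_ae ?_).trans_lt (hW_exp t)
    filter_upwards [hae] with p hp
    rw [hp, ← EReal.coe_mul, ← EReal.coe_neg, EReal.exp_coe]
  refine ⟨w, hwm, hae, fun t => ((hexp t).add (hexp (-t))).mono'
    (hwm.abs.const_mul t).exp.aestronglyMeasurable (ae_of_all _ fun p => ?_)⟩
  rw [Real.norm_of_nonneg (Real.exp_pos _).le]
  simp only [Pi.add_apply, neg_mul, neg_neg]
  have h3 := Real.exp_pos (-(t * w p))
  have h4 := Real.exp_pos (t * w p)
  rcases abs_cases (w p) with ⟨h, -⟩ | ⟨h, -⟩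
  · rw [h]; linarith
  · rw [h, mul_neg]; linarith

variable {μ₀ : Measure X} [IsProbabilityMeasure μ₀] {W : X → X → EReal} {w : X × X → ℝ}

lemma ereal_coe_finsetSum {ι : Type*} (s : Finset ι) (f : ι → ℝ) :
    ((∑ i ∈ s, f i : ℝ) : EReal) = ∑ i ∈ s, (f i : EReal) := by
  classical
  induction s using Finset.induction_on with
  | empty => simp
  | insert a s ha ih => rw [Finset.sum_insert ha, Finset.sum_insert ha, EReal.coe_add, ih]

/-- Each pair of distinct coordinates has law `μ₀ ⊗ μ₀`, so the exceptional null set pulls back to a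
null set. A diagonal term would not allow this. -/
lemma exp_meanFieldHamiltonian_ae_eq (hae : ∀ᵐ p ∂(μ₀.prod μ₀), W p.1 p.2 = (w p : EReal))
    (β : ℝ) (N : ℕ+) :
    (fun x => EReal.exp (-((β : EReal) * meanFieldHamiltonian W N x))) =ᵐ[Measure.pi fun _ : Fin N => μ₀]
      fun x => ENNReal.ofReal (Real.exp (-(β * ((N : ℝ)⁻¹ * pairSum w N x)))) := by
  have h1 : ∀ᵐ x ∂(Measure.pi fun _ : Fin N => μ₀),
      ∀ p : (Finset.univ : Finset (Fin N)).offDiag,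
        W (x p.1.1) (x p.1.2) = (w (x p.1.1, x p.1.2) : EReal) :=
    ae_all_iff.2 fun p => (measurePreserving_pi_pair μ₀
      (Finset.mem_offDiag.1 p.2).2.2).quasiMeasurePreserving.ae hae
  filter_upwards [h1] with x hx
  have h2 : meanFieldHamiltonian W N x = (((N : ℝ)⁻¹ * pairSum w N x : ℝ) : EReal) := by
    rw [meanFieldHamiltonian, EReal.coe_mul, pairSum, ereal_coe_finsetSum]
    exact congrArg _ (Finset.sum_congr rfl fun p hp => hx ⟨p, hp⟩)
  rw [h2, ← EReal.coe_mul, ← EReal.coe_neg, EReal.exp_coe]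

lemma gibbsWeight_eq_realGibbsWeight (hae : ∀ᵐ p ∂(μ₀.prod μ₀), W p.1 p.2 = (w p : EReal))
    (β : ℝ) (N : ℕ+) : gibbsWeight μ₀ W β N = realGibbsWeight μ₀ w β N :=
  withDensity_congr_ae (exp_meanFieldHamiltonian_ae_eq hae β N)

lemma partitionFunction_eq_gibbsWeight_univ (μ₀ : Measure X) (W : X → X → EReal) (β : ℝ)
    (N : ℕ+) : partitionFunction μ₀ W β N = gibbsWeight μ₀ W β N Set.univ := by
  rw [gibbsWeight, withDensity_apply _ MeasurableSet.univ, Measure.restrict_univ, partitionFunction]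

lemma realGibbsWeight_univ_pos (hw : Measurable w) (β : ℝ) (N : ℕ+) :
    0 < realGibbsWeight μ₀ w β N Set.univ := by
  have hF : Measurable fun x : Fin N → X =>
      ENNReal.ofReal (Real.exp (-(β * ((N : ℝ)⁻¹ * pairSum w N x)))) :=
    (((measurable_pairSum hw N).const_mul _).const_mul β).neg.exp.ennreal_ofReal
  rw [realGibbsWeight, withDensity_apply _ MeasurableSet.univ, Measure.restrict_univ,
    lintegral_pos_iff_support hF]
  have h : Function.support (fun x : Fin N → X =>
      ENNReal.ofReal (Real.exp (-(β * ((N : ℝ)⁻¹ * pairSum w N x))))) = Set.univ :=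
    Set.eq_univ_of_forall fun x => (ENNReal.ofReal_pos.2 (Real.exp_pos _)).ne'
  simp [h]

/-- Decoupling applied to `|β| |w|` reduces finiteness to an exponential moment of one pair. -/
lemma realGibbsWeight_univ_lt_top (hw : Measurable w)
    (hexp : ∀ t : ℝ, Integrable (fun p => Real.exp (t * |w p|)) (μ₀.prod μ₀)) (β : ℝ) (N : ℕ+) :
    realGibbsWeight μ₀ w β N Set.univ < ∞ := by
  rw [realGibbsWeight, withDensity_apply _ MeasurableSet.univ, Measure.restrict_univ]
  have h1 := lintegral_exp_pairSum_le μ₀ (g := fun p => |β| * |w p|) (hw.abs.const_mul _)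
    (fun p => by positivity) N
  refine (lintegral_mono fun x => ENNReal.ofReal_le_ofReal (Real.exp_le_exp.2 ?_)).trans_lt
    (h1.trans_lt (ENNReal.pow_lt_top ?_))
  · rw [← Finset.mul_sum]
    refine (neg_le_abs _).trans ?_
    rw [abs_mul, abs_mul, abs_of_nonneg (show (0 : ℝ) ≤ (N : ℝ)⁻¹ by positivity),
      mul_left_comm]
    gcongr
    exact Finset.abs_sum_le_sum_abs _ _
  · have h2 := hexp (2 * |β|)
    rw [← hasFiniteIntegral_iff_ofReal (ae_of_all _ fun p => (Real.exp_pos _).le)]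
    simpa only [mul_assoc] using h2.2

lemma prod_ae_eq_of_relEntropy_ne_top (hae : ∀ᵐ p ∂(μ₀.prod μ₀), W p.1 p.2 = (w p : EReal))
    {μ : ProbabilityMeasure X} (hμ : relEntropy μ₀ μ ≠ ∞) :
    ∀ᵐ p ∂((μ : Measure X).prod (μ : Measure X)), W p.1 p.2 = (w p : EReal) :=
  have hac := (InformationTheory.klDiv_ne_top_iff.1 hμ).1
  (hac.prod hac).ae_le hae

/-- Finite entropy gives `μ ⊗ μ ≪ μ₀ ⊗ μ₀`, so the almost everywhere identity carries over;
integrability prevents `∞ - ∞` in the energy. -/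
lemma freeEnergy_eq_realFreeEnergy (hae : ∀ᵐ p ∂(μ₀.prod μ₀), W p.1 p.2 = (w p : EReal)) (β : ℝ)
    (hint : ∀ μ : ProbabilityMeasure X, relEntropy μ₀ μ ≠ ∞ →
      Integrable w ((μ : Measure X).prod (μ : Measure X))) :
    freeEnergy μ₀ W β = realFreeEnergy μ₀ w β := by
  ext μ
  rw [freeEnergy, realFreeEnergy]
  split_ifs with hμ
  · rfl
  have hwi := hint μ hμ
  have hae' := prod_ae_eq_of_relEntropy_ne_top hae hμ
  have h1 : ∫⁻ p, (W p.1 p.2).toENNReal ∂((μ : Measure X).prod (μ : Measure X)) =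
      ∫⁻ p, ENNReal.ofReal (w p) ∂((μ : Measure X).prod (μ : Measure X)) :=
    lintegral_congr_ae (hae'.mono fun p hp => by
      beta_reduce; rw [hp, EReal.toENNReal_of_ne_top (EReal.coe_ne_top _), EReal.toReal_coe])
  have h2 : ∫⁻ p, (-W p.1 p.2).toENNReal ∂((μ : Measure X).prod (μ : Measure X)) =
      ∫⁻ p, ENNReal.ofReal (-w p) ∂((μ : Measure X).prod (μ : Measure X)) :=
    lintegral_congr_ae (hae'.mono fun p hp => by
      beta_reduce
      rw [hp, ← EReal.coe_neg, EReal.toENNReal_of_ne_top (EReal.coe_ne_top _), EReal.toReal_coe])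
  have hcoe : ∀ {a : ℝ≥0∞}, a ≠ ∞ → ((a : ℝ≥0∞) : EReal) = ((a.toReal : ℝ) : EReal) := fun h => by
    conv_lhs => rw [← ENNReal.ofReal_toReal h]
    rw [EReal.coe_ennreal_ofReal, max_eq_left ENNReal.toReal_nonneg]
  have h3 : pairEnergy W μ =
      ((∫ p, w p ∂((μ : Measure X).prod (μ : Measure X)) : ℝ) : EReal) := by
    rw [pairEnergy, h1, h2, integral_eq_lintegral_pos_part_sub_lintegral_neg_part hwi,
      EReal.coe_sub, ← hcoe, ← hcoe]
    · exact (lintegral_ofReal_le_lintegral_enorm _).trans_lt hwi.neg.2 |>.ne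
    · exact (lintegral_ofReal_le_lintegral_enorm _).trans_lt hwi.2 |>.ne
  rw [h3, hcoe hμ, ← EReal.coe_mul, ← EReal.coe_add]

end Reduction

/-! ### Assembly of the theorem. -/

theorem corollary1p4 {X : Type*} [TopologicalSpace X] [CompactSpace X]
    [TopologicalSpace.MetrizableSpace X] [MeasurableSpace X] [BorelSpace X]
    (μ₀ : Measure X) [IsProbabilityMeasure μ₀] (W : X → X → EReal)
    (hW_symm : ∀ x y, W x y = W y x)
    (hW_meas : AEMeasurable (fun p : X × X => W p.1 p.2) (μ₀.prod μ₀))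
    (hW_exp : ∀ t : ℝ,
      ∫⁻ p, EReal.exp (-((t : EReal) * W p.1 p.2)) ∂(μ₀.prod μ₀) < ∞)
    (β : ℝ) :
    -- the Gibbs measures are well defined
    (∀ N : ℕ+, 0 < partitionFunction μ₀ W β N ∧ partitionFunction μ₀ W β N < ∞) ∧
    -- the energy is well defined and finite wherever the entropy is finite
    (∀ μ : ProbabilityMeasure X, relEntropy μ₀ μ ≠ ∞ →
      ∫⁻ p, (W p.1 p.2).abs ∂((μ : Measure X).prod (μ : Measure X)) < ∞) ∧
    -- the LDP for the non-normalized measures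
    SatisfiesLDP (fun N => (gibbsWeight μ₀ W β N).map (empiricalMeasure N)) (fun N => (N : ℝ))
      (freeEnergy μ₀ W β) ∧
    -- the LDP for the laws of the empirical measures under the Gibbs measures
    ∃ c : ℝ, (⨅ μ : ProbabilityMeasure X, freeEnergy μ₀ W β μ) = (c : EReal) ∧
      SatisfiesLDP (fun N => (gibbsMeasure μ₀ W β N).map (empiricalMeasure N)) (fun N => (N : ℝ))
        (fun μ => freeEnergy μ₀ W β μ - (c : EReal)) := by
  obtain ⟨w, hw, hae, hexp⟩ := exists_real_interaction hW_meas hW_exp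
  obtain ⟨v, -, hv⟩ := exists_continuousMap_pair_approx μ₀ hw hexp β one_pos
  have hfree := freeEnergy_eq_realFreeEnergy hae β fun μ hμ => (hv μ hμ).1
  have hweight := gibbsWeight_eq_realGibbsWeight (μ₀ := μ₀) hae β
  have hub := localUpperBound_realGibbsWeight μ₀ hw hexp β
  have hlb := localLowerBound_realGibbsWeight μ₀ hw hexp β
  simp only [← hweight, ← hfree] at hub hlb
  have hbot : ∀ μ, freeEnergy μ₀ W β μ ≠ ⊥ := fun μ => by
    rw [hfree, realFreeEnergy]
    split_ifs
    · exact top_ne_bot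
    · exact EReal.coe_ne_bot _
  refine ⟨fun N => ?_, fun μ hμ => ?_, satisfiesLDP_of_local hbot hub hlb, ?_⟩
  · rw [partitionFunction_eq_gibbsWeight_univ, hweight]
    exact ⟨realGibbsWeight_univ_pos hw β N, realGibbsWeight_univ_lt_top hw hexp β N⟩
  · refine (lintegral_congr_ae ?_).trans_lt (hv μ hμ).1.2
    filter_upwards [prod_ae_eq_of_relEntropy_ne_top hae hμ] with p hp
    rw [hp, EReal.abs_def, Real.enorm_eq_ofReal_abs]
  · let ν₀ : ProbabilityMeasure X := ⟨μ₀, inferInstance⟩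
    have : Nonempty (ProbabilityMeasure X) := ⟨ν₀⟩
    -- The infimum is attained by compactness and lower semicontinuity. It is below `⊤` by
    -- comparison with `μ₀`, whose entropy is 0, and above `⊥` by `hbot`.
    obtain ⟨m, -, hm⟩ := (hub.lowerSemicontinuous hlb).lowerSemicontinuousOn Set.univ
      |>.exists_isMinOn Set.univ_nonempty isCompact_univ
    have hinf : ⨅ μ, freeEnergy μ₀ W β μ = freeEnergy μ₀ W β m :=
      le_antisymm (iInf_le _ m) (le_iInf fun μ => hm (Set.mem_univ μ))
    have htop : freeEnergy μ₀ W β m ≠ ⊤ := by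
      refine ne_top_of_le_ne_top ?_ (hm (Set.mem_univ ν₀))
      have h0 : relEntropy μ₀ ν₀ = 0 := InformationTheory.klDiv_self μ₀
      rw [hfree, realFreeEnergy, if_neg (by simp [h0])]
      exact EReal.coe_ne_top _
    have hc : ⨅ μ, freeEnergy μ₀ W β μ = ((freeEnergy μ₀ W β m).toReal : EReal) := by
      rw [hinf, EReal.coe_toReal htop (hbot m)]
    have hΓ : (fun N => (gibbsMeasure μ₀ W β N).map (empiricalMeasure N)) = fun N =>
        ((gibbsWeight μ₀ W β N).map (empiricalMeasure N) Set.univ)⁻¹ •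
          (gibbsWeight μ₀ W β N).map (empiricalMeasure N) := by
      ext1 N
      rw [gibbsMeasure, Measure.map_smul, partitionFunction_eq_gibbsWeight_univ,
        Measure.map_apply (measurable_empiricalMeasure N) MeasurableSet.univ, Set.preimage_univ]
    refine ⟨_, hc, ?_⟩
    rw [hΓ]
    refine satisfiesLDP_of_local (fun μ => ?_) (hub.normalized hc hlb)
      (LocalLowerBound.normalized hc hub hlb)
    rw [sub_eq_add_neg, ← EReal.coe_neg]
    exact fun h => (EReal.add_eq_bot_iff.1 h).elim (hbot μ) (EReal.coe_ne_bot _)
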